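/- Let $\mathbb K$ be $\mathbb R$ or $\mathbb C$, let $m,n_1,\dots,n_m$ be positive integers, put $M=\sum_{j=1}^m n_j$, let $p$ be a real number with $M<p\le 2M$, and let $s\in(0,+\infty)$. A map $P:\ell_p\times\cdots\times\ell_p\to\mathbb K$ ($m$ factors, $\ell_p=\ell_p(\mathbb N;\mathbb K)$) is called an $(n_1,\dots,n_m)$-homogeneous polynomial if, for each $i$ and all fixed values of the other variables, there is an $n_i$-linear form $T$ on $\ell_p$ such that $P(x^{(1)},\dots,x^{(m)})=T(x^{(i)},\dots,x^{(i)})$ for all $x^{(i)}\in\ell_p$. Its coefficients $c_{\alpha^{(1)}\cdots\alpha^{(m)}}(P)$, indexed by the multi-indices $\alpha^{(i)}\in(\mathbb N\cup\{0\})^{\mathbb N}$ with $|\alpha^{(i)}|=\sum_j\alpha^{(i)}_j=n_i$, are the unique scalars such that $$P(x^{(1)},\dots,x^{(m)})=\sum_{|\alpha^{(1)}|=n_1,\dots,|\alpha^{(m)}|=n_m}c_{\alpha^{(1)}\cdots\alpha^{(m)}}(P)\,(x^{(1)})^{\alpha^{(1)}}\cdots(x^{(m)})^{\alpha^{(m)}}$$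 for all finitely supported $x^{(1)},\dots,x^{(m)}$, and $\|P\|=\sup\{|P(x^{(1)},\dots,x^{(m)})|:\|x^{(i)}\|_p\le1\text{ for all }i\}\in[0,\infty]$. The following assertions are equivalent: (i) There is a constant $C\ge1$, depending only on $\mathbb K,n_1,\dots,n_m,p,s$, such that $$\Big(\sum_{|\alpha^{(1)}|=n_1,\dots,|\alpha^{(m)}|=n_m}\big|c_{\alpha^{(1)}\cdots\alpha^{(m)}}(P)\big|^s\Big)^{1/s}\le C\,\|P\|$$ for all $(n_1,\dots,n_m)$-homogeneous polynomials $P:\ell_p\times\cdots\times\ell_p\to\mathbb K$ (an inequality in $[0,\infty]$, trivial if $\|P\|=\infty$). (ii) $s\ge\dfrac{p}{p-M}$. -/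

import Mathlib

open scoped ENNReal

/-- `f : E → F` is a `k`-homogeneous polynomial: the restriction of a `k`-linear map to the diagonal. -/
def IsHomogeneousPoly (𝕜 : Type*) {E F : Type*} [RCLike 𝕜] [AddCommGroup E] [Module 𝕜 E]
    [AddCommGroup F] [Module 𝕜 F] (k : ℕ) (f : E → F) : Prop :=
  ∃ T : MultilinearMap 𝕜 (fun _ : Fin k => E) F, ∀ x, f x = T (fun _ => x)

/-- `P : E × ⋯ × E → F` is an `(n₁, …, nₘ)`-homogeneous polynomial: for each `i`, with all the other
variables frozen, it is an `nᵢ`-homogeneous polynomial of the `i`-th variable. -/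
def IsMultiPoly (𝕜 : Type*) {E F : Type*} [RCLike 𝕜] [AddCommGroup E] [Module 𝕜 E]
    [AddCommGroup F] [Module 𝕜 F] {m : ℕ} (n : Fin m → ℕ) (P : (Fin m → E) → F) : Prop :=
  ∀ (i : Fin m) (x : Fin m → E), IsHomogeneousPoly 𝕜 (n i) (fun y => P (Function.update x i y))

namespace MultiPolyAux
variable {𝕜 : Type*} [RCLike 𝕜]

theorem linIndep (σ : Type*) : LinearIndependent 𝕜
    (fun (α : σ →₀ ℕ) (y : σ → 𝕜) => α.prod fun j k => y j ^ k) := by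
  have h := (MvPolynomial.basisMonomials σ 𝕜).linearIndependent
  let φ : MvPolynomial σ 𝕜 →ₗ[𝕜] ((σ → 𝕜) → 𝕜) :=
    LinearMap.pi fun y => (MvPolynomial.aeval y).toLinearMap
  have hφ : LinearMap.ker φ = ⊥ := by
    rw [LinearMap.ker_eq_bot]
    intro p q hpq
    apply MvPolynomial.funext
    intro y
    have := congrFun hpq y
    simpa [φ, MvPolynomial.aeval_def] using this
  have h2 := h.map' φ hφ
  have he : (fun (α : σ →₀ ℕ) (y : σ → 𝕜) => α.prod fun j k => y j ^ k) =
      φ ∘ MvPolynomial.basisMonomials σ 𝕜 := by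
    ext α y
    simp [φ, MvPolynomial.aeval_monomial]
  rw [he]
  exact h2

theorem exists_functional {X ι : Type*} (g : ι → X → 𝕜) (hg : LinearIndependent 𝕜 g)
    (A : Finset ι) (a : ι) (ha : a ∈ A) :
    ∃ l : X →₀ 𝕜, ∀ c : ι → 𝕜, l.sum (fun y t => t * ∑ b ∈ A, c b * g b y) = c a := by
  classical
  let Φ : (X →₀ 𝕜) →ₗ[𝕜] (A → 𝕜) :=
    Finsupp.linearCombination 𝕜 (fun (y : X) (b : A) => g b y)
  have hr : LinearMap.range Φ = ⊤ := by
    by_contra hne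
    obtain ⟨φ, φ0, hφ⟩ := Submodule.exists_le_ker_of_lt_top _ (lt_top_iff_ne_top.2 hne)
    apply φ0
    have hφy : ∀ y : X, φ (fun b : A => g b y) = 0 := by
      intro y
      have : Φ (Finsupp.single y 1) ∈ LinearMap.ker φ := hφ ⟨_, rfl⟩
      simpa [Φ] using this
    have hA : LinearIndependent 𝕜 (fun b : A => g b) := hg.comp _ Subtype.val_injective
    rw [Fintype.linearIndependent_iff] at hA
    have hz := hA (fun b => φ (Pi.single b 1)) (by
      ext y
      have h1 := hφy y
      rw [LinearMap.pi_apply_eq_sum_univ] at h1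
      simp only [Finset.sum_apply, Pi.smul_apply, smul_eq_mul, Pi.zero_apply] at h1 ⊢
      rw [← h1]
      refine Finset.sum_congr rfl fun b _ => ?_
      rw [mul_comm]
      congr 2
      ext j
      simp [Pi.single_apply, eq_comm])
    ext b
    simpa using hz b
  have : Pi.single (⟨a, ha⟩ : A) (1 : 𝕜) ∈ LinearMap.range Φ := by rw [hr]; trivial
  obtain ⟨l, hl⟩ := this
  refine ⟨l, fun c => ?_⟩
  have h1 : ∀ b : A, l.sum (fun y t => t * g b y) = (Pi.single (⟨a, ha⟩ : A) (1 : 𝕜) : A → 𝕜) b := by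
    intro b
    rw [← hl]
    simp [Φ, Finsupp.linearCombination_apply, Finsupp.sum, Finset.sum_apply]
  calc l.sum (fun y t => t * ∑ b ∈ A, c b * g b y)
      = ∑ b ∈ A, c b * l.sum (fun y t => t * g b y) := by
        simp only [Finsupp.sum, Finset.mul_sum]
        rw [Finset.sum_comm]
        refine Finset.sum_congr rfl fun _ _ => Finset.sum_congr rfl fun _ _ => by ring
    _ = ∑ b : A, c b * l.sum (fun y t => t * g b y) := (Finset.sum_coe_sort A _).symm
    _ = c a := by
        simp only [h1]
        simp [Pi.single_apply]

theorem homogeneous_expand {V : Type*} [AddCommGroup V] [Module 𝕜 V] (e : ℕ → V) (k : ℕ)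
    (f : V → 𝕜) (hf : IsHomogeneousPoly 𝕜 k f) :
    ∃ c : (ℕ →₀ ℕ) → 𝕜, ∀ (F : Finset ℕ) (y : ℕ → 𝕜), f (∑ j ∈ F, y j • e j) =
      ∑ α ∈ F.finsuppAntidiag k, c α * α.prod fun j k => y j ^ k := by
  classical
  obtain ⟨T, hT⟩ := hf
  let ty : (Fin k → ℕ) → (ℕ →₀ ℕ) := fun φ => ∑ i, Finsupp.single (φ i) 1
  have hty : ∀ φ j, ty φ j = (Finset.univ.filter (fun i => φ i = j)).card := by
    intro φ j
    simp [ty, Finsupp.finsetSum_apply, Finsupp.single_apply]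
  have hmem : ∀ (φ : Fin k → ℕ) i, φ i ∈ (ty φ).support := by
    intro φ i
    rw [Finsupp.mem_support_iff, hty]
    exact Finset.card_ne_zero_of_mem (Finset.mem_filter.2 ⟨Finset.mem_univ i, rfl⟩)
  have hsupp : ∀ (φ : Fin k → ℕ) (F : Finset ℕ), (∀ i, φ i ∈ F) → (ty φ).support ⊆ F := by
    intro φ F h j hj
    rw [Finsupp.mem_support_iff, hty] at hj
    obtain ⟨i, hi⟩ := Finset.card_pos.1 (Nat.pos_of_ne_zero hj)
    simp at hi
    exact hi ▸ h i
  refine ⟨fun α => ∑ φ ∈ (Fintype.piFinset fun _ : Fin k => α.support).filter (fun φ => ty φ = α),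
    T (fun i => e (φ i)), fun F y => ?_⟩
  rw [hT, T.map_sum_finset (fun _ j => y j • e j) (fun _ => F)]
  rw [← Finset.sum_fiberwise_of_maps_to (g := ty) (t := F.finsuppAntidiag k)]
  · refine Finset.sum_congr rfl fun α hα => ?_
    rw [Finset.mem_finsuppAntidiag'] at hα
    rw [Finset.sum_mul]
    refine Finset.sum_congr ?_ ?_
    · ext φ
      simp only [Finset.mem_filter, Fintype.mem_piFinset]
      constructor
      · rintro ⟨_, rfl⟩
        exact ⟨hmem φ, rfl⟩
      · rintro ⟨h, rfl⟩
        exact ⟨fun i => hα.2 (h i), rfl⟩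
    · intro φ hφ
      rw [T.map_smul_univ (fun i => y (φ i)) (fun i => e (φ i)), smul_eq_mul, mul_comm]
      congr 1
      have : ty φ = α := (Finset.mem_filter.1 hφ).2
      rw [← this]
      simp only [ty]
      rw [← Finsupp.prod_finsetSum_index (h := fun j k => y j ^ k)
        (by intro; simp) (by intro a b c; exact pow_add _ _ _)]
      simp
  · intro φ hφ
    rw [Finset.mem_finsuppAntidiag']
    refine ⟨?_, hsupp φ F (Fintype.mem_piFinset.1 hφ)⟩
    simp only [ty]
    rw [← Finsupp.sum_finsetSum_index (h := fun _ k => k) (by simp) (by simp)]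
    simp

theorem IsHomogeneousPoly.sum {V X : Type*} [AddCommGroup V] [Module 𝕜 V] (k : ℕ)
    (S : Finset X) (t : X → 𝕜) (f : X → V → 𝕜) (hf : ∀ a, IsHomogeneousPoly 𝕜 k (f a)) :
    IsHomogeneousPoly 𝕜 k (fun v => ∑ a ∈ S, t a * f a v) := by
  choose T hT using hf
  exact ⟨∑ a ∈ S, t a • T a, fun x => by simp [hT]⟩

theorem multi_expand {V : Type*} [AddCommGroup V] [Module 𝕜 V] (e : ℕ → V) (m : ℕ) :
    ∀ (n : Fin m → ℕ) (P : (Fin m → V) → 𝕜), IsMultiPoly 𝕜 n P →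
    ∃ c : (Fin m → ℕ →₀ ℕ) → 𝕜, ∀ (F : Finset ℕ) (y : Fin m → ℕ → 𝕜),
      P (fun i => ∑ j ∈ F, y i j • e j) =
      ∑ α ∈ Fintype.piFinset (fun i => F.finsuppAntidiag (n i)),
        c α * ∏ i, (α i).prod fun j k => y i j ^ k := by
  classical
  induction m with
  | zero =>
    intro n P _
    refine ⟨fun _ => P Fin.elim0, fun F y => ?_⟩
    simp only [Finset.univ_eq_empty, Finset.prod_empty, mul_one]
    rw [Finset.sum_const, Fintype.card_piFinset]
    simp
    congr 1
    exact Subsingleton.elim _ _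
  | succ m ih =>
    intro n P hP
    have key : ∀ a : ℕ →₀ ℕ, ∃ l : (ℕ → 𝕜) →₀ 𝕜, a.degree = n 0 → ∀ c : (ℕ →₀ ℕ) → 𝕜,
        l.sum (fun y t => t * ∑ b ∈ a.support.finsuppAntidiag (n 0),
          c b * b.prod fun j k => y j ^ k) = c a := by
      intro a
      by_cases h : a.degree = n 0
      · obtain ⟨l, hl⟩ := exists_functional _ (linIndep (𝕜 := 𝕜) ℕ)
          (a.support.finsuppAntidiag (n 0)) a
          (by rw [Finset.mem_finsuppAntidiag]; exact ⟨h, subset_rfl⟩)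
        exact ⟨l, fun _ => hl⟩
      · exact ⟨0, fun h' => absurd h' h⟩
    choose l hl using key
    let R : (ℕ →₀ ℕ) → (Fin m → V) → 𝕜 := fun a x =>
      (l a).sum fun y t => t * P (Fin.cons (∑ j ∈ a.support, y j • e j) x)
    have hR : ∀ a, IsMultiPoly 𝕜 (Fin.tail n) (R a) := by
      intro a i x
      have h : ∀ y : ℕ → 𝕜, IsHomogeneousPoly 𝕜 (Fin.tail n i) (fun v =>
          P (Fin.cons (∑ j ∈ a.support, y j • e j) (Function.update x i v))) := by
        intro y
        have h1 := hP i.succ (Fin.cons (∑ j ∈ a.support, y j • e j) x)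
        simp only [← Fin.cons_update] at h1
        exact h1
      exact IsHomogeneousPoly.sum (Fin.tail n i) (l a).support (l a) _ h
    choose d hd using fun a => ih _ _ (hR a)
    refine ⟨fun α => d (α 0) (Fin.tail α), fun F y => ?_⟩
    set x' : Fin m → V := fun i => ∑ j ∈ F, y i.succ j • e j with hx'
    have hx : (fun i => ∑ j ∈ F, y i j • e j) = (Fin.cons (∑ j ∈ F, y 0 j • e j) x' :
        Fin (m + 1) → V) := by
      ext i; refine Fin.cases ?_ (fun i => ?_) i <;> simp [hx']
    obtain ⟨c, hc⟩ := homogeneous_expand e (n 0) (fun v => P (Fin.cons v x')) (by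
      have := hP 0 (Fin.cons 0 x')
      simpa using this)
    have hcR : ∀ a : ℕ →₀ ℕ, a.degree = n 0 → c a = R a x' := by
      intro a ha
      rw [← hl a ha c]
      simp only [R, Finsupp.sum]
      refine Finset.sum_congr rfl fun z _ => ?_
      rw [← hc]
    rw [hx, hc]
    have : ∀ a ∈ F.finsuppAntidiag (n 0), c a = ∑ α ∈ Fintype.piFinset
        (fun i => F.finsuppAntidiag (Fin.tail n i)),
        d a α * ∏ i, (α i).prod fun j k => y i.succ j ^ k := by
      intro a ha
      rw [Finset.mem_finsuppAntidiag'] at ha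
      rw [hcR a ha.1, hd a F (fun i => y i.succ)]
    rw [Finset.sum_congr rfl fun a ha => by rw [this a ha]]
    simp only [Finset.sum_mul]
    rw [← Finset.sum_product']
    refine Finset.sum_bij' (fun q _ => (Fin.cons q.1 q.2 : Fin (m + 1) → ℕ →₀ ℕ))
      (fun α _ => (α 0, Fin.tail α)) ?_ ?_ ?_ ?_ ?_
    · intro q hq
      rw [Finset.mem_product] at hq
      rw [Fin.mem_piFinset_iff_zero_tail]
      exact hq
    · intro α hα
      rw [Fin.mem_piFinset_iff_zero_tail] at hα
      exact Finset.mem_product.2 hα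
    · intro q _; simp
    · intro α _; simp
    · intro q _
      simp [Fin.prod_univ_succ]
      ring

theorem finite_hasSum {m : ℕ} (n : Fin m → ℕ) (C : (Fin m → ℕ →₀ ℕ) → 𝕜) (x : Fin m → ℕ → 𝕜)
    (F : Finset ℕ) (hF : ∀ i, ∀ j ∉ F, x i j = 0) :
    HasSum (fun α : {α : Fin m → ℕ →₀ ℕ // ∀ i, (α i).degree = n i} =>
      C α.1 * ∏ i, (α.1 i).prod fun j k => x i j ^ k)
    (∑ α ∈ Fintype.piFinset (fun i => F.finsuppAntidiag (n i)),
        C α * ∏ i, (α i).prod fun j k => x i j ^ k) := by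
  classical
  have hA : ∀ α ∈ Fintype.piFinset (fun i => F.finsuppAntidiag (n i)),
      ∀ i, (α i).degree = n i := by
    intro α hα i
    exact (Finset.mem_finsuppAntidiag'.1 (Fintype.mem_piFinset.1 hα i)).1
  rw [← Finset.sum_subtype_of_mem (fun α => C α * ∏ i, (α i).prod fun j k => x i j ^ k) hA]
  refine hasSum_sum_of_ne_finset_zero fun α hα => ?_
  rw [Finset.mem_subtype, Fintype.mem_piFinset] at hα
  push Not at hα
  obtain ⟨i, hi⟩ := hα
  rw [Finset.mem_finsuppAntidiag'] at hi
  have : ¬ (α.1 i).support ⊆ F := fun h => hi ⟨α.2 i, h⟩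
  obtain ⟨j, hj, hjF⟩ := Finset.not_subset.1 this
  have hz : ((α.1 i).prod fun j k => x i j ^ k) = 0 := by
    refine Finset.prod_eq_zero hj ?_
    show x i j ^ (α.1 i) j = 0
    rw [hF i j hjF]
    exact zero_pow (Finsupp.mem_support_iff.1 hj)
  rw [Finset.prod_eq_zero (Finset.mem_univ i) hz, mul_zero]

theorem coeff_zero {m : ℕ} (n : Fin m → ℕ) (C : (Fin m → ℕ →₀ ℕ) → 𝕜)
    (h : ∀ (F : Finset ℕ) (y : Fin m → ℕ → 𝕜), (∀ i, ∀ j ∉ F, y i j = 0) →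
      ∑ α ∈ Fintype.piFinset (fun i => F.finsuppAntidiag (n i)),
        C α * ∏ i, (α i).prod (fun j k => y i j ^ k) = 0)
    (α : Fin m → ℕ →₀ ℕ) (hα : ∀ i, (α i).degree = n i) : C α = 0 := by
  classical
  let F : Finset ℕ := Finset.univ.biUnion fun i => (α i).support
  let E := (Finsupp.sigmaFinsuppEquivPiFinsupp (α := ℕ) (ιs := fun _ : Fin m => ℕ)).symm
  have hli := (linIndep (𝕜 := 𝕜) (Σ _ : Fin m, ℕ)).comp E E.injective
  rw [linearIndependent_iff'] at hli
  refine hli (Fintype.piFinset (fun i => F.finsuppAntidiag (n i))) C ?_ α ?_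
  · ext y
    rw [Finset.sum_apply, Pi.zero_apply]
    rw [← h F (fun i j => if j ∈ F then y ⟨i, j⟩ else 0) (by intro i j hj; simp [hj])]
    refine Finset.sum_congr rfl fun β hβ => ?_
    simp only [Pi.smul_apply, smul_eq_mul, Function.comp]
    congr 1
    have hs : ∀ i, (β i).support ⊆ F := fun i =>
      (Finset.mem_finsuppAntidiag'.1 (Fintype.mem_piFinset.1 hβ i)).2
    have hE : ∀ s, E β s = β s.1 s.2 := fun s => rfl
    rw [Finsupp.prod_of_support_subset (s := Finset.univ.sigma fun _ => F)]
    · rw [Finset.prod_sigma]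
      refine Finset.prod_congr rfl fun i _ => ?_
      rw [Finsupp.prod_of_support_subset _ (hs i) _ (by simp)]
      refine Finset.prod_congr rfl fun j hj => ?_
      simp [hj, hE]
    · intro s hs'
      rw [Finsupp.mem_support_iff, hE] at hs'
      simp only [Finset.mem_sigma, Finset.mem_univ, true_and]
      exact hs s.1 (Finsupp.mem_support_iff.2 hs')
    · simp
  · rw [Fintype.mem_piFinset]
    intro i
    rw [Finset.mem_finsuppAntidiag']
    exact ⟨hα i, Finset.subset_biUnion_of_mem (fun i => (α i).support) (Finset.mem_univ i)⟩

theorem lp_eq_sum (p : ℝ≥0∞) (x : lp (fun _ : ℕ => 𝕜) p) (F : Finset ℕ)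
    (hF : ∀ j ∉ F, x j = 0) : x = ∑ j ∈ F, x j • lp.single (E := fun _ : ℕ => 𝕜) p j 1 := by
  ext j
  rw [lp.coeFn_sum]
  simp [Pi.single_apply]
  intro hj
  exact hF j hj

end MultiPolyAux

/-- Families `(α⁽¹⁾, …, α⁽ᵐ⁾)` of multi-indices with `|α⁽ⁱ⁾| = nᵢ`; having finite sum, each `α⁽ⁱ⁾` is a
finitely supported sequence of natural numbers. -/
abbrev MultiIndex {m : ℕ} (n : Fin m → ℕ) : Type :=
  {α : Fin m → ℕ →₀ ℕ // ∀ i, (α i).degree = n i}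

/-- The monomial `(x⁽¹⁾)^α⁽¹⁾ ⋯ (x⁽ᵐ⁾)^α⁽ᵐ⁾`. -/
noncomputable def monomialValue {𝕜 : Type*} [RCLike 𝕜] {m : ℕ} (α : Fin m → ℕ →₀ ℕ)
    (x : Fin m → ℕ → 𝕜) : 𝕜 :=
  ∏ i, (α i).prod fun j k => x i j ^ k

/-- `c` is the family of coefficients of the monomial expansion of `P`. The expansion is asked for at
finitely supported sequences, where only finitely many terms are nonzero; at a general point of `ℓ_p`
the series need not converge unconditionally. -/
def IsMonomialExpansion {𝕜 : Type*} [RCLike 𝕜] {p : ℝ≥0∞} {m : ℕ} (n : Fin m → ℕ)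
    (P : (Fin m → lp (fun _ : ℕ => 𝕜) p) → 𝕜) (c : MultiIndex n → 𝕜) : Prop :=
  ∀ x : Fin m → lp (fun _ : ℕ => 𝕜) p, (∀ i, (Function.support (x i)).Finite) →
    HasSum (fun α : MultiIndex n => c α * monomialValue α.1 (fun i => x i)) (P x)

theorem IsMultiPoly.existsUnique_expansion {𝕜 : Type*} [RCLike 𝕜] {p : ℝ≥0∞} {m : ℕ}
    {n : Fin m → ℕ}
    {P : (Fin m → lp (fun _ : ℕ => 𝕜) p) → 𝕜} (hP : IsMultiPoly 𝕜 n P) :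
    ∃! c : MultiIndex n → 𝕜, IsMonomialExpansion n P c := by
  classical
  obtain ⟨c, hc⟩ := MultiPolyAux.multi_expand (fun j => lp.single (E := fun _ : ℕ => 𝕜) p j 1) m n P hP
  refine ⟨fun α => c α.1, ?_, ?_⟩
  · intro x hx
    let F : Finset ℕ := Finset.univ.biUnion fun i => (hx i).toFinset
    have hF : ∀ i, ∀ j ∉ F, x i j = 0 := by
      intro i j hj
      by_contra h
      exact hj (Finset.mem_biUnion.2 ⟨i, Finset.mem_univ i, (hx i).mem_toFinset.2 h⟩)
    have h1 := hc F (fun i j => x i j)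
    have h2 : (fun i => ∑ j ∈ F, x i j • lp.single (E := fun _ : ℕ => 𝕜) p j 1) = x :=
      funext fun i => (MultiPolyAux.lp_eq_sum p (x i) F (hF i)).symm
    rw [h2] at h1
    rw [h1]
    exact MultiPolyAux.finite_hasSum n c (fun i => x i) F hF
  · intro d hd
    let D : (Fin m → ℕ →₀ ℕ) → 𝕜 := fun α =>
      if h : ∀ i, (α i).degree = n i then d ⟨α, h⟩ - c α else 0
    have hD := MultiPolyAux.coeff_zero n D (by
      intro F y hy
      let x : Fin m → lp (fun _ : ℕ => 𝕜) p :=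
        fun i => ∑ j ∈ F, y i j • lp.single (E := fun _ : ℕ => 𝕜) p j 1
      have hxy : ∀ i, (x i : ℕ → 𝕜) = y i := by
        intro i
        ext j
        simp only [x]
        rw [lp.coeFn_sum]
        simp [Pi.single_apply]
        intro hj
        exact (hy i j hj).symm
      have h1 := hd x (by
        intro i
        rw [hxy]
        refine F.finite_toSet.subset fun j hj => ?_
        by_contra h
        exact hj (hy i j h))
      have h2 := MultiPolyAux.finite_hasSum n c y F hy
      rw [← hc F y] at h2
      have h3 := h1.sub h2
      rw [sub_self] at h3
      have he : (fun α : MultiIndex n =>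
          D α.1 * ∏ i, (α.1 i).prod fun j k => y i j ^ k) = fun α : MultiIndex n =>
          d α * monomialValue α.1 (fun i => x i) -
            c α.1 * ∏ i, (α.1 i).prod fun j k => y i j ^ k := by
        funext α
        simp only [D, dif_pos α.2, monomialValue, hxy]
        ring
      have h4 := MultiPolyAux.finite_hasSum n D y F hy
      rw [he] at h4
      exact h4.unique h3)
    ext α
    have := hD α.1 α.2
    simp only [D, dif_pos α.2] at this
    exact sub_eq_zero.1 this

/-- The coefficients `c_{α⁽¹⁾…α⁽ᵐ⁾}(P)` of a multipolynomial on `ℓ_p × ⋯ × ℓ_p`. -/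
noncomputable def multiCoeff {𝕜 : Type*} [RCLike 𝕜] {p : ℝ≥0∞} {m : ℕ} {n : Fin m → ℕ}
    {P : (Fin m → lp (fun _ : ℕ => 𝕜) p) → 𝕜} (hP : IsMultiPoly 𝕜 n P) : MultiIndex n → 𝕜 :=
  hP.existsUnique_expansion.choose

theorem multiCoeff_spec {𝕜 : Type*} [RCLike 𝕜] {p : ℝ≥0∞} {m : ℕ} {n : Fin m → ℕ}
    {P : (Fin m → lp (fun _ : ℕ => 𝕜) p) → 𝕜} (hP : IsMultiPoly 𝕜 n P) :
    IsMonomialExpansion n P (multiCoeff hP) :=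
  hP.existsUnique_expansion.choose_spec.1

/-- The supremum of `|P|` over the product of the closed unit balls; it is `∞` if `P` is unbounded
there. -/
noncomputable def multiNorm {𝕜 : Type*} [RCLike 𝕜] {p : ℝ≥0∞} {m : ℕ}
    (P : (Fin m → lp (fun _ : ℕ => 𝕜) p) → 𝕜) : ℝ≥0∞ :=
  ⨆ (x : Fin m → lp (fun _ : ℕ => 𝕜) p) (_ : ∀ i, ‖x i‖ ≤ 1), ‖P x‖ₑ

/-!
Write `M = n₁ + ⋯ + nₘ`, so that `s ≥ p / (p - M)` means `1 / s ≤ 1 - M / p`.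

The condition is necessary because the diagonal polynomial `∑_{j < N} ∏ᵢ (x⁽ⁱ⁾_j)^nᵢ` has `N` coefficients
equal to `1`, while the arithmetic-geometric and power mean inequalities bound its norm by
`N ^ (1 - M / p)`; letting `N` grow compares the exponents.

For the sufficiency, polarization (`polarization`, `norm_symmForm_le`) replaces the polynomial by an
`M`-linear form `∑ a_φ ∏ yᵢ(φ i)` on finitely supported sequences. Both the loss in the norm and the number
of terms `a_φ` sharing one coefficient are bounded in terms of `M` alone, so it remains to prove the
Hardy–Littlewood inequality `∑ ‖a_φ‖ ^ s ≤ (C ‖a‖) ^ s` for `s = p / (p - M)`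
(`sum_rpow_le_of_form_le_fin`). Two facts give it.

* Khinchine's inequality in all variables but the `k`-th, and a choice of phases in the `k`-th, give for
  all nonnegative weights `wᵢ` in the unit ball of `ℓ_p` and every `k` the bound
  `∑_j (∑_{φ k = j} (‖a_φ‖ ∏ wᵢ(φ i))²)^(1/2) ≤ 2 ^ (M - 1) ‖a‖` (`sum_sqrt_le_of_form_le`).
* After normalization, `b_φ = ‖a_φ‖ ^ s` is a probability distribution. With weights `wᵢ = Bᵢ ^ (1/p)`, where
  `Bᵢ` is the `i`-th marginal of `b`, the left side above, formed with `b_φ ^ (1/s)` in place of `‖a_φ‖`,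
  is at least `1` for some `k` (`exists_one_le_sum_sqrt`). By the Cauchy–Schwarz inequality on each fibre and the
  inequality of the means over `k`, its average over `k` is at least
  `∑_φ b_φ ∏ᵢ (Bᵢ(φ i) / b_φ) ^ (1/p - 1/(2M))`; the exponent is nonnegative exactly when `p ≤ 2 M`, and
  `b_φ ≤ Bᵢ(φ i)`.
-/

namespace MultiPolyAux

/-! ### Khinchine inequalities -/

section Khinchine

variable {𝕜 : Type*} [RCLike 𝕜] {E : Type*} [NormedAddCommGroup E] [InnerProductSpace 𝕜 E]
  {J : Type*} [Fintype J] [DecidableEq J]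

/-- Adding a symmetric random sign times a fixed vector can be averaged over the two signs. -/
theorem sum_signs_insert (f : E → ℝ) (x : J → E) {t : Finset J} {j : J} (hj : j ∉ t) :
    2 * ∑ ε : J → ℤˣ, f (∑ i ∈ insert j t, ((ε i : ℤ) : 𝕜) • x i) =
      ∑ ε : J → ℤˣ, (f (∑ i ∈ t, ((ε i : ℤ) : 𝕜) • x i + x j) +
        f (∑ i ∈ t, ((ε i : ℤ) : 𝕜) • x i - x j)) := by
  have h1 := Equiv.sum_comp (Equiv.mulLeft (Pi.mulSingle j (-1 : ℤˣ) : J → ℤˣ))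
    fun ε : J → ℤˣ => f (∑ i ∈ insert j t, ((ε i : ℤ) : 𝕜) • x i)
  rw [two_mul]
  nth_rewrite 1 [← h1]
  rw [← Finset.sum_add_distrib]
  refine Finset.sum_congr rfl fun ε _ => ?_
  have h2 : ∑ i ∈ t, ((((Equiv.mulLeft (Pi.mulSingle j (-1 : ℤˣ) : J → ℤˣ)) ε i : ℤˣ) : ℤ) : 𝕜) • x i
      = ∑ i ∈ t, ((ε i : ℤ) : 𝕜) • x i := by
    refine Finset.sum_congr rfl fun i hi => ?_
    have hij : i ≠ j := fun h => hj (h ▸ hi)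
    simp [Pi.mulSingle_eq_of_ne hij]
  rw [Finset.sum_insert hj, Finset.sum_insert hj, h2]
  rcases Int.units_eq_one_or (ε j) with h | h <;> simp [h, sub_eq_neg_add, add_comm]

theorem sum_signs_norm_sq (x : J → E) (t : Finset J) :
    ∑ ε : J → ℤˣ, ‖∑ i ∈ t, ((ε i : ℤ) : 𝕜) • x i‖ ^ 2 =
      Fintype.card (J → ℤˣ) * ∑ i ∈ t, ‖x i‖ ^ 2 := by
  induction t using Finset.induction_on with
  | empty => simp
  | insert j t hj ih =>
    have h := sum_signs_insert (𝕜 := 𝕜) (fun v : E => ‖v‖ ^ 2) x hj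
    have h2 : ∀ u v : E, ‖u + v‖ ^ 2 + ‖u - v‖ ^ 2 = 2 * ‖u‖ ^ 2 + 2 * ‖v‖ ^ 2 := by
      intro u v
      have := parallelogram_law_with_norm 𝕜 u v
      nlinarith
    simp only [h2, Finset.sum_add_distrib, ← Finset.mul_sum, ih, Finset.sum_const,
      Finset.card_univ, nsmul_eq_mul] at h
    rw [Finset.sum_insert hj]
    linarith

theorem sum_signs_norm_pow_four (x : J → E) (t : Finset J) :
    ∑ ε : J → ℤˣ, ‖∑ i ∈ t, ((ε i : ℤ) : 𝕜) • x i‖ ^ 4 ≤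
      Fintype.card (J → ℤˣ) * (3 * (∑ i ∈ t, ‖x i‖ ^ 2) ^ 2) := by
  induction t using Finset.induction_on with
  | empty => simp
  | insert j t hj ih =>
    have h := sum_signs_insert (𝕜 := 𝕜) (fun v : E => ‖v‖ ^ 4) x hj
    have h2 : ∀ u v : E, ‖u + v‖ ^ 4 + ‖u - v‖ ^ 4 ≤
        2 * ‖u‖ ^ 4 + 12 * ‖v‖ ^ 2 * ‖u‖ ^ 2 + 2 * ‖v‖ ^ 4 := by
      intro u v
      have h3 := norm_add_sq (𝕜 := 𝕜) u v
      have h4 := norm_sub_sq (𝕜 := 𝕜) u v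
      have h5 : (RCLike.re (inner 𝕜 u v)) ^ 2 ≤ ‖u‖ ^ 2 * ‖v‖ ^ 2 := by
        rw [← mul_pow, sq_le_sq, abs_of_nonneg (by positivity : 0 ≤ ‖u‖ * ‖v‖)]
        exact (RCLike.abs_re_le_norm _).trans (norm_inner_le_norm u v)
      have e : ∀ z : E, ‖z‖ ^ 4 = (‖z‖ ^ 2) ^ 2 := fun z => by ring
      rw [e (u + v), e (u - v), h3, h4]
      nlinarith
    have h6 : ∑ ε : J → ℤˣ, (‖∑ i ∈ t, ((ε i : ℤ) : 𝕜) • x i + x j‖ ^ 4 +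
        ‖∑ i ∈ t, ((ε i : ℤ) : 𝕜) • x i - x j‖ ^ 4) ≤ _ :=
      Finset.sum_le_sum fun ε _ => h2 _ _
    rw [← h] at h6
    simp only [Finset.sum_add_distrib, ← Finset.mul_sum, sum_signs_norm_sq (𝕜 := 𝕜) x t,
      Finset.sum_const, Finset.card_univ, nsmul_eq_mul] at h6
    rw [Finset.sum_insert hj]
    have h7 : (0 : ℝ) ≤ Fintype.card (J → ℤˣ) * ‖x j‖ ^ 4 := by positivity
    nlinarith

/-- Khinchine's inequality between the first and second moments, for vectors of an inner product
space. -/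
theorem khinchine (x : J → E) :
    Fintype.card (J → ℤˣ) * √(∑ i, ‖x i‖ ^ 2) ≤
      2 * ∑ ε : J → ℤˣ, ‖∑ i, ((ε i : ℤ) : 𝕜) • x i‖ := by
  set V := ∑ i, ‖x i‖ ^ 2 with hV
  have hV0 : 0 ≤ V := by positivity
  rcases hV0.eq_or_lt with h0 | h0
  · rw [← h0]; simp; positivity
  set r := √V
  have hr : 0 < r := Real.sqrt_pos.2 h0
  have hrV : r ^ 2 = V := Real.sq_sqrt hV0
  have h2 := sum_signs_norm_sq (𝕜 := 𝕜) x Finset.univ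
  have h4 := sum_signs_norm_pow_four (𝕜 := 𝕜) x Finset.univ
  rw [← hV, ← hrV] at h2 h4
  -- The tangent inequality `3 t² - t⁴ ≤ 2 t`, rescaled by `2 r`.
  have key : ∀ t : ℝ, 0 ≤ t → 12 * r ^ 2 * t ^ 2 - t ^ 4 ≤ 16 * r ^ 3 * t := by
    intro t ht
    have : 16 * r ^ 3 * t - (12 * r ^ 2 * t ^ 2 - t ^ 4) = t * ((t - 2 * r) ^ 2 * (t + 4 * r)) := by
      ring
    have : 0 ≤ t * ((t - 2 * r) ^ 2 * (t + 4 * r)) := by positivity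
    linarith
  have h5 := Finset.sum_le_sum fun (ε : J → ℤˣ) (_ : ε ∈ Finset.univ) =>
    key ‖∑ i, ((ε i : ℤ) : 𝕜) • x i‖ (norm_nonneg _)
  rw [Finset.sum_sub_distrib, ← Finset.mul_sum, ← Finset.mul_sum, h2] at h5
  set T := ∑ ε : J → ℤˣ, ‖∑ i, ((ε i : ℤ) : 𝕜) • x i‖
  have hc : (0 : ℝ) ≤ Fintype.card (J → ℤˣ) := by positivity
  set c : ℝ := (Fintype.card (J → ℤˣ) : ℝ)
  have h6 : r ^ 3 * (9 * (c * r)) ≤ r ^ 3 * (16 * T) := by nlinarith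
  have h7 := le_of_mul_le_mul_left h6 (by positivity)
  have h8 : 0 ≤ c * r := by positivity
  linarith

/-- Khinchine's inequality for decoupled Rademacher chaos of degree `d`. -/
theorem khinchine_chaos (d : ℕ) (b : (Fin d → J) → 𝕜) :
    Fintype.card (Fin d → J → ℤˣ) * √(∑ φ, ‖b φ‖ ^ 2) ≤
      2 ^ d * ∑ ε : Fin d → J → ℤˣ, ‖∑ φ : Fin d → J, b φ * ∏ i, ((ε i (φ i) : ℤ) : 𝕜)‖ := by
  induction d with
  | zero => simp [Real.sqrt_sq]
  | succ d ih =>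
    let x : J → EuclideanSpace 𝕜 (Fin d → J) := fun j =>
      WithLp.toLp 2 fun φ => b (Fin.cons j φ)
    have hx := khinchine (𝕜 := 𝕜) x
    have hcard : (Fintype.card (Fin (d + 1) → J → ℤˣ) : ℝ) =
        Fintype.card (J → ℤˣ) * Fintype.card (Fin d → J → ℤˣ) := by
      rw [← Nat.cast_mul, ← Fintype.card_prod]
      exact_mod_cast (Fintype.card_congr (Fin.consEquiv fun _ => J → ℤˣ)).symm
    have hsum : ∑ φ, ‖b φ‖ ^ 2 = ∑ j, ‖x j‖ ^ 2 := by
      rw [← (Fin.consEquiv fun _ => J).sum_comp, Fintype.sum_prod_type]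
      refine Finset.sum_congr rfl fun j _ => ?_
      rw [EuclideanSpace.norm_sq_eq]
      rfl
    rw [hcard, hsum]
    have h1 : ∀ ε : J → ℤˣ, Fintype.card (Fin d → J → ℤˣ) * ‖∑ i, ((ε i : ℤ) : 𝕜) • x i‖ ≤
        2 ^ d * ∑ η : Fin d → J → ℤˣ, ‖∑ φ : Fin (d + 1) → J, b φ *
          ∏ i, (((Fin.cons ε η : Fin (d + 1) → J → ℤˣ) i (φ i) : ℤ) : 𝕜)‖ := by
      intro ε
      have h2 := ih fun φ => ∑ j, ((ε j : ℤ) : 𝕜) * b (Fin.cons j φ)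
      have h3 : √(∑ φ, ‖∑ j, ((ε j : ℤ) : 𝕜) * b (Fin.cons j φ)‖ ^ 2) =
          ‖∑ i, ((ε i : ℤ) : 𝕜) • x i‖ := by
        rw [EuclideanSpace.norm_eq]
        congr 1
        refine Finset.sum_congr rfl fun φ _ => ?_
        simp [x]
      rw [h3] at h2
      refine h2.trans (le_of_eq ?_)
      congr 1
      refine Finset.sum_congr rfl fun η _ => ?_
      congr 1
      rw [← (Fin.consEquiv fun _ => J).sum_comp, Fintype.sum_prod_type, Finset.sum_comm]
      refine Finset.sum_congr rfl fun φ _ => ?_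
      rw [Finset.sum_mul]
      refine Finset.sum_congr rfl fun j _ => ?_
      simp [Fin.consEquiv, Fin.prod_univ_succ]
      ring
    rw [← (Fin.consEquiv fun _ => J → ℤˣ).sum_comp, Fintype.sum_prod_type]
    have h4 := Finset.sum_le_sum fun (ε : J → ℤˣ) (_ : ε ∈ Finset.univ) => h1 ε
    rw [← Finset.mul_sum, ← Finset.mul_sum] at h4
    have h5 : (0 : ℝ) ≤ Fintype.card (Fin d → J → ℤˣ) := by positivity
    calc _ = Fintype.card (Fin d → J → ℤˣ) * (Fintype.card (J → ℤˣ) * √(∑ j, ‖x j‖ ^ 2)) := by ring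
      _ ≤ Fintype.card (Fin d → J → ℤˣ) * (2 * ∑ ε : J → ℤˣ, ‖∑ i, ((ε i : ℤ) : 𝕜) • x i‖) := by
        gcongr
      _ = 2 * (Fintype.card (Fin d → J → ℤˣ) * ∑ ε : J → ℤˣ, ‖∑ i, ((ε i : ℤ) : 𝕜) • x i‖) := by ring
      _ ≤ _ := by
        rw [pow_succ', mul_assoc 2 ((2 : ℝ) ^ d)]
        exact mul_le_mul_of_nonneg_left h4 zero_le_two

end Khinchine

/-! ### The Hardy–Littlewood inequality for multilinear forms -/

section Forms

variable {𝕜 : Type*} [RCLike 𝕜] {J : Type*} [Fintype J] [DecidableEq J]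

/-- A mixed `(ℓ₁, ℓ₂)` inequality: the coefficients of a bounded multilinear form on `ℓ_p`, weighted
by points of the unit ball, are summable in the order `1` in the variable `k` and in the order `2` in
the others. -/
theorem sum_sqrt_le_of_form_le {d : ℕ} (a : (Fin (d + 1) → J) → 𝕜) {p K : ℝ} (hp : 0 < p)
    (hK : ∀ y : Fin (d + 1) → J → 𝕜, (∀ i, ∑ j, ‖y i j‖ ^ p ≤ 1) →
      ‖∑ φ, a φ * ∏ i, y i (φ i)‖ ≤ K)
    (w : Fin (d + 1) → J → ℝ) (hw0 : ∀ i j, 0 ≤ w i j) (hw : ∀ i, ∑ j, w i j ^ p ≤ 1)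
    (k : Fin (d + 1)) :
    ∑ j, √(∑ φ with φ k = j, (‖a φ‖ * ∏ i, w i (φ i)) ^ 2) ≤ 2 ^ d * K := by
  let b : J → (Fin d → J) → 𝕜 := fun j ψ =>
    a (k.insertNth j ψ) * ((w k j * ∏ i, w (k.succAbove i) (ψ i) : ℝ) : 𝕜)
  have hb : ∀ j, ∑ φ with φ k = j, (‖a φ‖ * ∏ i, w i (φ i)) ^ 2 = ∑ ψ, ‖b j ψ‖ ^ 2 := by
    intro j
    rw [Finset.sum_filter, ← (Fin.insertNthEquiv (fun _ => J) k).sum_comp, Fintype.sum_prod_type,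
      Finset.sum_eq_single j]
    · refine Finset.sum_congr rfl fun ψ _ => ?_
      have h : 0 ≤ w k j * ∏ i, w (k.succAbove i) (ψ i) :=
        mul_nonneg (hw0 _ _) (Finset.prod_nonneg fun _ _ => hw0 _ _)
      simp only [b, norm_mul, RCLike.norm_ofReal, abs_of_nonneg h]
      simp [Fin.prod_univ_succAbove _ k, Fin.insertNthEquiv]
    · intro j' _ hj'
      simp [hj']
    · simp
  simp only [hb]
  have hsign : ∀ ε : Fin d → J → ℤˣ,
      ∑ j, ‖∑ ψ : Fin d → J, b j ψ * ∏ i, ((ε i (ψ i) : ℤ) : 𝕜)‖ ≤ K := by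
    intro ε
    -- The phases of the variable `k` are chosen so that all terms add up.
    have hθ : ∀ z : 𝕜, ∃ θ : 𝕜, ‖θ‖ ≤ 1 ∧ θ * z = (‖z‖ : 𝕜) := by
      intro z
      by_cases hz : z = 0
      · exact ⟨0, by simp, by simp [hz]⟩
      · refine ⟨(‖z‖ : 𝕜) / z, ?_, div_mul_cancel₀ _ hz⟩
        simp [norm_div, div_self (norm_ne_zero_iff.2 hz)]
    choose θ hθ1 hθ2 using fun j => hθ (∑ ψ : Fin d → J, b j ψ * ∏ i, ((ε i (ψ i) : ℤ) : 𝕜))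
    let y : Fin (d + 1) → J → 𝕜 := k.insertNth (fun j => (w k j : 𝕜) * θ j)
      (fun i j => (w (k.succAbove i) j : 𝕜) * ((ε i j : ℤ) : 𝕜))
    have hy : ∀ i, ∑ j, ‖y i j‖ ^ p ≤ 1 := by
      intro i
      refine le_trans (Finset.sum_le_sum fun j _ => ?_) (hw i)
      refine Real.rpow_le_rpow (norm_nonneg _) ?_ hp.le
      refine Fin.succAboveCases k ?_ (fun i => ?_) i
      · simp only [y, Fin.insertNth_apply_same, norm_mul, RCLike.norm_ofReal,
          abs_of_nonneg (hw0 _ _)]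
        exact mul_le_of_le_one_right (hw0 _ _) (hθ1 j)
      · simp only [y, Fin.insertNth_apply_succAbove, norm_mul, RCLike.norm_ofReal,
          abs_of_nonneg (hw0 _ _)]
        rcases Int.units_eq_one_or (ε i j) with h | h <;> simp [h]
    have h1 := hK y hy
    have h2 : ∑ φ, a φ * ∏ i, y i (φ i) =
        ((∑ j, ‖∑ ψ : Fin d → J, b j ψ * ∏ i, ((ε i (ψ i) : ℤ) : 𝕜)‖ : ℝ) : 𝕜) := by
      rw [← (Fin.insertNthEquiv (fun _ => J) k).sum_comp, Fintype.sum_prod_type]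
      rw [RCLike.ofReal_sum]
      refine Finset.sum_congr rfl fun j _ => ?_
      refine Eq.trans ?_ (hθ2 j)
      rw [Finset.mul_sum]
      refine Finset.sum_congr rfl fun ψ _ => ?_
      have hins : Fin.insertNthEquiv (fun _ => J) k (j, ψ) = k.insertNth j ψ := rfl
      simp only [y, b, hins, Fin.prod_univ_succAbove _ k,
        Fin.insertNth_apply_same, Fin.insertNth_apply_succAbove, Finset.prod_mul_distrib]
      push_cast
      ring
    rw [h2, RCLike.norm_ofReal] at h1
    exact (le_abs_self _).trans h1
  have h3 := Finset.sum_le_sum fun (j : J) (_ : j ∈ Finset.univ) => khinchine_chaos d (b j)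
  rw [← Finset.mul_sum, ← Finset.mul_sum, Finset.sum_comm] at h3
  have h4 := Finset.sum_le_sum fun (ε : Fin d → J → ℤˣ) (_ : ε ∈ Finset.univ) => hsign ε
  rw [Finset.sum_const, Finset.card_univ, nsmul_eq_mul] at h4
  have hc : (0 : ℝ) < Fintype.card (Fin d → J → ℤˣ) := by exact_mod_cast Fintype.card_pos
  refine le_of_mul_le_mul_left (h3.trans ?_) hc
  calc _ ≤ 2 ^ d * (Fintype.card (Fin d → J → ℤˣ) * K) := by gcongr
    _ = _ := by ring

/-- For a probability distribution `b` on `I → J`, weighting by suitable powers of its marginals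
makes the mixed sums large for at least one coordinate. Cauchy–Schwarz on the fibres of each coordinate
and the inequality of the means over the coordinates reduce this to the fact that `b` is dominated by each
of its marginals. -/
theorem exists_one_le_sum_sqrt {I : Type*} [Fintype I] [Nonempty I] [DecidableEq I] {p : ℝ}
    (hp : 0 < p) (hpM : p ≤ 2 * (Fintype.card I : ℝ)) (b : (I → J) → ℝ)
    (hb : ∀ φ, 0 ≤ b φ) (hb1 : ∑ φ, b φ = 1) :
    ∃ k, 1 ≤ ∑ j, √(∑ φ with φ k = j, (b φ ^ (1 - Fintype.card I / p) *
      ∏ i, (∑ ψ with ψ i = φ i, b ψ) ^ (1 / p)) ^ 2) := by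
  set M : ℝ := (Fintype.card I : ℝ) with hM
  have hMpos : 0 < M := by rw [hM]; exact_mod_cast Fintype.card_pos
  set r : ℝ := 1 - M / p with hr
  set B : I → J → ℝ := fun i j => ∑ ψ with ψ i = j, b ψ with hB
  have hB0 : ∀ i j, 0 ≤ B i j := fun i j => Finset.sum_nonneg fun _ _ => hb _
  have hbB : ∀ φ i, b φ ≤ B i (φ i) := fun φ i =>
    Finset.single_le_sum (f := b) (fun _ _ => hb _) (by simp)
  set W : (I → J) → ℝ := fun φ => b φ ^ r * ∏ i, B i (φ i) ^ (1 / p) with hW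
  have hW0 : ∀ φ, 0 ≤ W φ := fun φ => mul_nonneg (Real.rpow_nonneg (hb φ) _)
    (Finset.prod_nonneg fun i _ => Real.rpow_nonneg (hB0 _ _) _)
  by_contra! hlt
  have hCS : ∀ k j, ∑ φ with φ k = j, √(b φ) * W φ * (√(B k (φ k)))⁻¹ ≤
      √(∑ φ with φ k = j, W φ ^ 2) := by
    intro k j
    have h1 := Real.sum_mul_le_sqrt_mul_sqrt (Finset.univ.filter fun φ : I → J => φ k = j)
      (fun φ => √(b φ)) W
    simp only [Real.sq_sqrt (hb _)] at h1
    calc ∑ φ with φ k = j, √(b φ) * W φ * (√(B k (φ k)))⁻¹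
        = (∑ φ with φ k = j, √(b φ) * W φ) * (√(B k j))⁻¹ := by
          rw [Finset.sum_mul]
          refine Finset.sum_congr rfl fun φ hφ => ?_
          rw [(Finset.mem_filter.1 hφ).2]
      _ ≤ (√(B k j) * √(∑ φ with φ k = j, W φ ^ 2)) * (√(B k j))⁻¹ := by
          gcongr
      _ ≤ √(∑ φ with φ k = j, W φ ^ 2) := by
          rw [mul_right_comm]
          refine mul_le_of_le_one_left (Real.sqrt_nonneg _) ?_
          -- With the convention `0⁻¹ = 0` this includes the case `B k j = 0`.
          exact mul_inv_le_one
  have hk : ∀ k, ∑ φ, √(b φ) * W φ * (√(B k (φ k)))⁻¹ < 1 := by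
    intro k
    refine lt_of_le_of_lt ?_ (hlt k)
    rw [← Finset.sum_fiberwise (g := fun φ : I → J => φ k)]
    exact Finset.sum_le_sum fun j _ => hCS k j
  have hsum : ∑ φ, √(b φ) * W φ * ∑ k, (√(B k (φ k)))⁻¹ < M := by
    have := Finset.sum_lt_sum_of_nonempty (Finset.univ_nonempty (α := I)) fun k _ => hk k
    rw [Finset.sum_comm] at this
    simpa [Finset.mul_sum, hM] using this
  have hpt : ∀ φ, M * b φ ≤ √(b φ) * W φ * ∑ k, (√(B k (φ k)))⁻¹ := by
    intro φ
    rcases (hb φ).eq_or_lt with h0 | h0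
    · rw [← h0]; simp
    have hBpos : ∀ i, 0 < B i (φ i) := fun i => h0.trans_le (hbB φ i)
    have hAG : ∏ k, (√(B k (φ k)))⁻¹ ^ (1 / M) ≤ ∑ k, 1 / M * (√(B k (φ k)))⁻¹ :=
      Real.geom_mean_le_arith_mean_weighted _ _ _ (fun _ _ => by positivity)
        (by simp [hM]) (fun _ _ => by positivity)
    rw [← Finset.mul_sum] at hAG
    have hAG' : M * ∏ k, (√(B k (φ k)))⁻¹ ^ (1 / M) ≤ ∑ k, (√(B k (φ k)))⁻¹ := by
      calc _ ≤ M * (1 / M * ∑ k, (√(B k (φ k)))⁻¹) := by gcongr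
        _ = _ := by field_simp
    -- Only here is the assumption `p ≤ 2 M` needed.
    have hδ : 0 ≤ 1 / p - 1 / (2 * M) := by
      rw [sub_nonneg]
      exact one_div_le_one_div_of_le hp hpM
    have hprod : b φ ^ (M * (1 / p - 1 / (2 * M))) ≤
        (∏ i, B i (φ i) ^ (1 / p)) * ∏ k, (√(B k (φ k)))⁻¹ ^ (1 / M) := by
      rw [← Finset.prod_mul_distrib]
      calc b φ ^ (M * (1 / p - 1 / (2 * M))) = ∏ _i : I, b φ ^ (1 / p - 1 / (2 * M)) := by
            rw [Finset.prod_const, Finset.card_univ, ← Real.rpow_natCast, ← Real.rpow_mul h0.le,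
              mul_comm]
        _ ≤ ∏ i, B i (φ i) ^ (1 / p - 1 / (2 * M)) :=
            Finset.prod_le_prod (fun _ _ => by positivity) fun i _ =>
              Real.rpow_le_rpow h0.le (hbB φ i) hδ
        _ = _ := by
            refine Finset.prod_congr rfl fun i _ => ?_
            rw [Real.sqrt_eq_rpow, ← Real.rpow_neg (hBpos i).le, ← Real.rpow_mul (hBpos i).le,
              ← Real.rpow_add (hBpos i)]
            congr 1
            field_simp
            ring
    have hexp : 1 / 2 + (r + M * (1 / p - 1 / (2 * M))) = 1 := by
      rw [hr]; field_simp; ring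
    calc M * b φ = M * (√(b φ) * (b φ ^ r * b φ ^ (M * (1 / p - 1 / (2 * M))))) := by
          rw [Real.sqrt_eq_rpow, ← Real.rpow_add h0, ← Real.rpow_add h0, hexp, Real.rpow_one]
      _ ≤ M * (√(b φ) * (b φ ^ r * ((∏ i, B i (φ i) ^ (1 / p)) *
            ∏ k, (√(B k (φ k)))⁻¹ ^ (1 / M)))) := by gcongr
      _ = √(b φ) * W φ * (M * ∏ k, (√(B k (φ k)))⁻¹ ^ (1 / M)) := by
          simp only [hW]; ring
      _ ≤ _ := by
          have := hW0 φ
          gcongr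
  have := Finset.sum_le_sum fun (φ : I → J) (_ : φ ∈ Finset.univ) => hpt φ
  rw [← Finset.mul_sum, hb1, mul_one] at this
  exact absurd (this.trans_lt hsum) (lt_irrefl _)

/-- The Hardy–Littlewood inequality for multilinear forms on `ℓ_p`, in the range `M < p ≤ 2 M`. -/
theorem sum_rpow_le_of_form_le_fin {d : ℕ} (a : (Fin (d + 1) → J) → 𝕜) {p K : ℝ}
    (hMp : ((d + 1 : ℕ) : ℝ) < p) (hpM : p ≤ 2 * ((d + 1 : ℕ) : ℝ))
    (hK : ∀ y : Fin (d + 1) → J → 𝕜, (∀ i, ∑ j, ‖y i j‖ ^ p ≤ 1) →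
      ‖∑ φ, a φ * ∏ i, y i (φ i)‖ ≤ K) :
    ∑ φ, ‖a φ‖ ^ (p / (p - (d + 1 : ℕ))) ≤ (2 ^ d * K) ^ (p / (p - (d + 1 : ℕ))) := by
  set M : ℝ := ((d + 1 : ℕ) : ℝ) with hM
  have hM0 : 0 < M := by rw [hM]; positivity
  have hp : 0 < p := hM0.trans hMp
  have hpM' : 0 < p - M := sub_pos.2 hMp
  set s := p / (p - M) with hs
  have hs0 : 0 < s := div_pos hp hpM'
  have hsr : s * (1 - M / p) = 1 := by rw [hs]; field_simp
  have hK0 : 0 ≤ K := by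
    have := hK 0 (by intro i; simp [Real.zero_rpow hp.ne'])
    exact (norm_nonneg _).trans this
  set S := ∑ φ, ‖a φ‖ ^ s with hS
  have hS0 : 0 ≤ S := Finset.sum_nonneg fun _ _ => by positivity
  rcases hS0.eq_or_lt with h0 | h0
  · rw [← h0]; positivity
  set b : (Fin (d + 1) → J) → ℝ := fun φ => ‖a φ‖ ^ s / S with hbdef
  have hb : ∀ φ, 0 ≤ b φ := fun φ => by positivity
  have hb1 : ∑ φ, b φ = 1 := by
    rw [← Finset.sum_div, div_self h0.ne']
  obtain ⟨k, hk⟩ := exists_one_le_sum_sqrt hp (by simpa [hM] using hpM) b hb hb1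
  have hcard : (Fintype.card (Fin (d + 1)) : ℝ) = M := by simp [hM]
  rw [hcard] at hk
  have hB0 : ∀ i j, 0 ≤ ∑ ψ with ψ i = j, b ψ := fun i j => Finset.sum_nonneg fun _ _ => hb _
  have hmix := sum_sqrt_le_of_form_le a hp hK
    (fun i j => (∑ ψ with ψ i = j, b ψ) ^ (1 / p)) (fun i j => Real.rpow_nonneg (hB0 i j) _)
    (fun i => by
      have : ∀ j, ((∑ ψ with ψ i = j, b ψ) ^ (1 / p)) ^ p = ∑ ψ with ψ i = j, b ψ := by
        intro j
        rw [← Real.rpow_mul (hB0 i j), one_div_mul_cancel hp.ne', Real.rpow_one]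
      simp only [this]
      rw [Finset.sum_fiberwise, hb1]) k
  have hbr : ∀ φ, b φ ^ (1 - M / p) = ‖a φ‖ * (S ^ (1 - M / p))⁻¹ := by
    intro φ
    rw [hbdef]
    simp only
    rw [Real.div_rpow (by positivity) hS0, ← Real.rpow_mul (norm_nonneg _), hsr, Real.rpow_one,
      div_eq_mul_inv]
  have hSr : 0 < S ^ (1 - M / p) := Real.rpow_pos_of_pos h0 _
  have hrew : ∀ j, √(∑ φ with φ k = j, (b φ ^ (1 - M / p) *
      ∏ i, (∑ ψ with ψ i = φ i, b ψ) ^ (1 / p)) ^ 2) = (S ^ (1 - M / p))⁻¹ *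
      √(∑ φ with φ k = j, (‖a φ‖ * ∏ i, (∑ ψ with ψ i = φ i, b ψ) ^ (1 / p)) ^ 2) := by
    intro j
    have h : ∀ φ, (b φ ^ (1 - M / p) * ∏ i, (∑ ψ with ψ i = φ i, b ψ) ^ (1 / p)) ^ 2 =
        ((S ^ (1 - M / p))⁻¹) ^ 2 *
          (‖a φ‖ * ∏ i, (∑ ψ with ψ i = φ i, b ψ) ^ (1 / p)) ^ 2 := by
      intro φ
      rw [hbr]; ring
    simp only [h]
    rw [← Finset.mul_sum, Real.sqrt_mul (by positivity), Real.sqrt_sq (by positivity)]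
  simp only [hrew] at hk
  rw [← Finset.mul_sum, ← div_eq_inv_mul, one_le_div hSr] at hk
  have h5 := Real.rpow_le_rpow hSr.le (hk.trans hmix) hs0.le
  rwa [← Real.rpow_mul hS0, mul_comm (1 - M / p) s, hsr, Real.rpow_one] at h5

/-- The Hardy–Littlewood inequality for an arbitrary finite set of variables and every exponent above
the critical one. -/
theorem sum_rpow_le_of_form_le {I : Type*} [Fintype I] [Nonempty I] [DecidableEq I]
    (a : (I → J) → 𝕜) {p s K : ℝ}
    (hMp : (Fintype.card I : ℝ) < p) (hpM : p ≤ 2 * (Fintype.card I : ℝ))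
    (hs : p / (p - Fintype.card I) ≤ s)
    (hK : ∀ y : I → J → 𝕜, (∀ i, ∑ j, ‖y i j‖ ^ p ≤ 1) → ‖∑ φ, a φ * ∏ i, y i (φ i)‖ ≤ K) :
    ∑ φ, ‖a φ‖ ^ s ≤ (2 ^ Fintype.card I * K) ^ s := by
  obtain ⟨d, hd⟩ : ∃ d, Fintype.card I = d + 1 :=
    Nat.exists_eq_succ_of_ne_zero Fintype.card_ne_zero
  let e : I ≃ Fin (d + 1) := Fintype.equivFinOfCardEq hd
  rw [hd] at hMp hpM hs ⊢
  have hp : 0 < p := lt_of_le_of_lt (by positivity) hMp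
  have hK0 : 0 ≤ K := by
    have := hK 0 (by intro i; simp [Real.zero_rpow hp.ne'])
    exact (norm_nonneg _).trans this
  let E : (Fin (d + 1) → J) ≃ (I → J) := Equiv.arrowCongr e.symm (Equiv.refl J)
  have hE : ∀ φ i, E φ i = φ (e i) := fun φ i => rfl
  have h := sum_rpow_le_of_form_le_fin (fun φ => a (E φ)) hMp hpM (K := K) (by
    intro y hy
    have h1 := hK (fun i => y (e i)) (fun i => hy (e i))
    rw [← E.sum_comp] at h1
    simp only [hE] at h1
    simpa only [e.prod_comp (fun i => y i _)] using (by
      refine le_of_eq_of_le ?_ h1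
      congr 1
      refine Finset.sum_congr rfl fun φ _ => ?_
      rw [← e.prod_comp]))
  set s₀ := p / (p - (d + 1 : ℕ)) with hs₀
  have hs₀0 : 0 < s₀ := div_pos hp (sub_pos.2 hMp)
  rw [E.sum_comp (fun φ => ‖a φ‖ ^ s₀)] at h
  set L := 2 ^ d * K with hL
  have hL0 : 0 ≤ L := by positivity
  have hle : ∀ φ, ‖a φ‖ ≤ L := by
    intro φ
    have h1 : ‖a φ‖ ^ s₀ ≤ L ^ s₀ :=
      (Finset.single_le_sum (f := fun φ => ‖a φ‖ ^ s₀) (fun _ _ => by positivity)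
        (Finset.mem_univ φ)).trans h
    exact (Real.rpow_le_rpow_iff (norm_nonneg _) hL0 hs₀0).1 h1
  have hsplit : ∀ t : ℝ, 0 ≤ t → t ^ s = t ^ s₀ * t ^ (s - s₀) := by
    intro t ht
    rw [← Real.rpow_add_of_nonneg ht hs₀0.le (sub_nonneg.2 hs)]
    congr 1; ring
  calc ∑ φ, ‖a φ‖ ^ s ≤ ∑ φ, ‖a φ‖ ^ s₀ * L ^ (s - s₀) := by
        refine Finset.sum_le_sum fun φ _ => ?_
        rw [hsplit _ (norm_nonneg _)]
        exact mul_le_mul_of_nonneg_left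
          (Real.rpow_le_rpow (norm_nonneg _) (hle φ) (sub_nonneg.2 hs)) (by positivity)
    _ = (∑ φ, ‖a φ‖ ^ s₀) * L ^ (s - s₀) := by rw [Finset.sum_mul]
    _ ≤ L ^ s₀ * L ^ (s - s₀) := by gcongr
    _ = L ^ s := (hsplit L hL0).symm
    _ ≤ _ := by
        refine Real.rpow_le_rpow hL0 ?_ (hs₀0.le.trans hs)
        rw [hL, pow_succ]
        have : 0 ≤ 2 ^ d * K := hL0
        linarith

end Forms

/-! ### Polarization -/

section Polarization

variable {𝕜 : Type*} [RCLike 𝕜] {I : Type*} [Fintype I] [DecidableEq I]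

theorem sum_signs_prod_of_bijective {κ : I → I} (hκ : κ.Bijective) :
    ∑ ε : I → ℤˣ, (∏ i, ((ε i : ℤ) : 𝕜)) * ∏ i, ((ε (κ i) : ℤ) : 𝕜) =
      Fintype.card (I → ℤˣ) := by
  have h : ∀ ε : I → ℤˣ, (∏ i, ((ε i : ℤ) : 𝕜)) * ∏ i, ((ε (κ i) : ℤ) : 𝕜) = 1 := by
    intro ε
    rw [hκ.prod_comp (fun i => ((ε i : ℤ) : 𝕜)), ← Finset.prod_mul_distrib]
    refine Finset.prod_eq_one fun i _ => ?_
    rcases Int.units_eq_one_or (ε i) with h | h <;> simp [h]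
  simp [h]

theorem sum_signs_prod_of_not_surjective {κ : I → I} (hκ : ¬ κ.Surjective) :
    ∑ ε : I → ℤˣ, (∏ i, ((ε i : ℤ) : 𝕜)) * ∏ i, ((ε (κ i) : ℤ) : 𝕜) = 0 := by
  simp only [Function.Surjective, not_forall, not_exists] at hκ
  obtain ⟨i₀, h₀⟩ := hκ
  -- Flipping the sign of the index `i₀` missed by `κ` changes the sign of every term.
  have h1 := Equiv.sum_comp (Equiv.mulLeft (Pi.mulSingle i₀ (-1 : ℤˣ) : I → ℤˣ))
    fun ε : I → ℤˣ => (∏ i, ((ε i : ℤ) : 𝕜)) * ∏ i, ((ε (κ i) : ℤ) : 𝕜)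
  have h2 : ∀ ε : I → ℤˣ,
      (∏ i, ((((Equiv.mulLeft (Pi.mulSingle i₀ (-1 : ℤˣ) : I → ℤˣ)) ε i : ℤˣ) : ℤ) : 𝕜)) *
      ∏ i, ((((Equiv.mulLeft (Pi.mulSingle i₀ (-1 : ℤˣ) : I → ℤˣ)) ε (κ i) : ℤˣ) : ℤ) : 𝕜) =
      -((∏ i, ((ε i : ℤ) : 𝕜)) * ∏ i, ((ε (κ i) : ℤ) : 𝕜)) := by
    intro ε
    have h3 : ∏ i, (((Pi.mulSingle i₀ (-1 : ℤˣ) : I → ℤˣ) i : ℤ) : 𝕜) = -1 := by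
      rw [Finset.prod_eq_single i₀]
      · simp
      · intro i _ hi
        simp [Pi.mulSingle_eq_of_ne hi]
      · simp
    have h4 : ∀ i, (Pi.mulSingle i₀ (-1 : ℤˣ) : I → ℤˣ) (κ i) = 1 := fun i =>
      Pi.mulSingle_eq_of_ne (h₀ i) _
    simp only [Equiv.coe_mulLeft, Pi.mul_apply, Units.val_mul, Int.cast_mul,
      Finset.prod_mul_distrib, h3, h4]
    simp
  simp only [h2, Finset.sum_neg_distrib] at h1
  exact self_eq_neg.1 h1.symm

/-- The polarization formula. The variables indexed by `I` are grouped in blocks by `β`, and the form with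
coefficients `a` is symmetric inside each block; up to a positive integer factor it is then a signed
average of the values it takes when the variables within each block agree. -/
theorem polarization {B J : Type*} [DecidableEq B] [Fintype J] (β : I → B) (a : (I → J) → 𝕜)
    (ha : ∀ σ : Equiv.Perm I, (∀ i, β (σ i) = β i) → ∀ φ : I → J, a (φ ∘ σ) = a φ)
    (y : I → J → 𝕜) :
    ∃ N : ℕ, 0 < N ∧ ∑ ε : I → ℤˣ, (∏ i, ((ε i : ℤ) : 𝕜)) *
        ∑ φ, a φ * ∏ i, ∑ k with β k = β i, ((ε k : ℤ) : 𝕜) * y k (φ i) =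
      N * Fintype.card (I → ℤˣ) * ∑ φ, a φ * ∏ i, y i (φ i) := by
  classical
  set K : Finset (I → I) := Fintype.piFinset fun i => Finset.univ.filter fun k => β k = β i with hK
  have hmemK : ∀ κ, κ ∈ K ↔ ∀ i, β (κ i) = β i := by
    intro κ; simp [hK, Fintype.mem_piFinset]
  refine ⟨(K.filter Function.Bijective).card, Finset.card_pos.2
    ⟨id, Finset.mem_filter.2 ⟨(hmemK _).2 fun _ => rfl, Function.bijective_id⟩⟩, ?_⟩
  have hexp : ∀ (ε : I → ℤˣ) (φ : I → J),
      ∏ i, ∑ k with β k = β i, ((ε k : ℤ) : 𝕜) * y k (φ i) =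
      ∑ κ ∈ K, (∏ i, ((ε (κ i) : ℤ) : 𝕜)) * ∏ i, y (κ i) (φ i) := by
    intro ε φ
    rw [Finset.prod_univ_sum]
    exact Finset.sum_congr rfl fun κ _ => Finset.prod_mul_distrib
  have hsym : ∀ κ ∈ K.filter Function.Bijective,
      ∑ φ, a φ * ∏ i, y (κ i) (φ i) = ∑ φ, a φ * ∏ i, y i (φ i) := by
    intro κ hκ
    obtain ⟨hκ1, hκ2⟩ := Finset.mem_filter.1 hκ
    let σ : Equiv.Perm I := Equiv.ofBijective κ hκ2
    rw [← (Equiv.arrowCongr σ.symm (Equiv.refl J)).sum_comp]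
    refine Finset.sum_congr rfl fun φ _ => ?_
    have h1 : Equiv.arrowCongr σ.symm (Equiv.refl J) φ = φ ∘ σ := by
      ext i; simp [Equiv.arrowCongr]
    rw [h1, ha σ ((hmemK κ).1 hκ1), ← Equiv.prod_comp σ fun i => y i (φ i)]
    rfl
  calc ∑ ε : I → ℤˣ, (∏ i, ((ε i : ℤ) : 𝕜)) *
        ∑ φ, a φ * ∏ i, ∑ k with β k = β i, ((ε k : ℤ) : 𝕜) * y k (φ i)
      = ∑ κ ∈ K, (∑ ε : I → ℤˣ, (∏ i, ((ε i : ℤ) : 𝕜)) * ∏ i, ((ε (κ i) : ℤ) : 𝕜)) *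
          ∑ φ, a φ * ∏ i, y (κ i) (φ i) := by
        simp only [hexp, Finset.mul_sum, Finset.sum_mul]
        rw [Finset.sum_comm]
        rw [Finset.sum_comm (s := K)]
        refine Finset.sum_congr rfl fun φ _ => ?_
        rw [Finset.sum_comm]
        refine Finset.sum_congr rfl fun κ _ => Finset.sum_congr rfl fun ε _ => ?_
        ring
    _ = ∑ κ ∈ K.filter Function.Bijective,
          Fintype.card (I → ℤˣ) * ∑ φ, a φ * ∏ i, y i (φ i) := by
        rw [Finset.sum_filter]
        refine Finset.sum_congr rfl fun κ hκ => ?_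
        split_ifs with h
        · rw [sum_signs_prod_of_bijective h, hsym κ (Finset.mem_filter.2 ⟨hκ, h⟩)]
        · rw [sum_signs_prod_of_not_surjective
            fun hs => h (Finite.surjective_iff_bijective.1 hs), zero_mul]
    _ = _ := by
        rw [Finset.sum_const, nsmul_eq_mul, mul_assoc]

end Polarization

/-! ### Summability of the coefficients of a polynomial -/

section Sufficiency

variable {𝕜 : Type*} [RCLike 𝕜]

/-- The sequence in `ℓ_p` supported in the finite set `F` with prescribed entries there. -/
noncomputable def lpOfFinset (𝕜 : Type*) [RCLike 𝕜] (p : ℝ≥0∞) (F : Finset ℕ) :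
    (F → 𝕜) →ₗ[𝕜] lp (fun _ : ℕ => 𝕜) p :=
  ∑ j : F, (lp.lsingle (E := fun _ : ℕ => 𝕜) (𝕜 := 𝕜) p (j : ℕ)).comp (LinearMap.proj j)

theorem lpOfFinset_eq_sum (p : ℝ≥0∞) (F : Finset ℕ) (y : F → 𝕜) :
    lpOfFinset 𝕜 p F y =
      ∑ j ∈ F, lp.single (E := fun _ : ℕ => 𝕜) p j (if h : j ∈ F then y ⟨j, h⟩ else 0) := by
  rw [← Finset.sum_coe_sort F]
  simp [lpOfFinset]

theorem lpOfFinset_apply_mem (p : ℝ≥0∞) (F : Finset ℕ) (y : F → 𝕜) (j : F) :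
    lpOfFinset 𝕜 p F y j = y j := by
  rw [lpOfFinset_eq_sum, lp.coeFn_sum]
  simp [Pi.single_apply]

theorem lpOfFinset_apply_notMem (p : ℝ≥0∞) (F : Finset ℕ) (y : F → 𝕜) {j : ℕ} (hj : j ∉ F) :
    lpOfFinset 𝕜 p F y j = 0 := by
  rw [lpOfFinset_eq_sum, lp.coeFn_sum]
  simp [Pi.single_apply, hj]

theorem norm_lpOfFinset_rpow {p : ℝ≥0∞} (hp : 0 < p.toReal) (F : Finset ℕ) (y : F → 𝕜) :
    ‖lpOfFinset 𝕜 p F y‖ ^ p.toReal = ∑ j, ‖y j‖ ^ p.toReal := by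
  rw [lpOfFinset_eq_sum, lp.norm_sum_single hp, ← Finset.sum_coe_sort F]
  simp

variable {m : ℕ} {n : Fin m → ℕ}

/-- The family of multi-indices counting, in each block `i`, how often each value is taken by `φ`.
The index set `Σ i, Fin (n i)` lists the `n₁ + ⋯ + nₘ` scalar variables of the polarized form. -/
noncomputable def countMultiIndex (n : Fin m → ℕ) (φ : (Σ i, Fin (n i)) → ℕ) : MultiIndex n :=
  ⟨fun i => ∑ ι, if ι.1 = i then Finsupp.single (φ ι) 1 else 0, fun i => by
    have h : ∀ ι : Σ i, Fin (n i),
        (if ι.1 = i then Finsupp.single (φ ι) 1 else 0 : ℕ →₀ ℕ).degree =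
          if ι.1 = i then 1 else 0 := by
      intro ι; split_ifs <;> simp
    simp only [map_sum, h]
    rw [Fintype.sum_sigma]
    simp [apply_ite Finset.card]⟩

theorem countMultiIndex_comp (φ : (Σ i, Fin (n i)) → ℕ) (σ : Equiv.Perm (Σ i, Fin (n i)))
    (hσ : ∀ ι, (σ ι).1 = ι.1) : countMultiIndex n (φ ∘ σ) = countMultiIndex n φ := by
  apply Subtype.ext
  funext i
  simp only [countMultiIndex]
  rw [← Equiv.sum_comp σ fun ι => if ι.1 = i then Finsupp.single (φ ι) 1 else 0]
  simp [hσ]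

theorem monomialValue_countMultiIndex (φ : (Σ i, Fin (n i)) → ℕ) (x : Fin m → ℕ → 𝕜) :
    monomialValue (countMultiIndex n φ).1 x = ∏ ι : Σ i, Fin (n i), x ι.1 (φ ι) := by
  classical
  simp only [monomialValue, countMultiIndex]
  have h : ∀ i, (∑ ι : Σ i, Fin (n i), if ι.1 = i then Finsupp.single (φ ι) 1 else 0).prod
      (fun j k => x i j ^ k) = ∏ ι : Σ i, Fin (n i), if ι.1 = i then x i (φ ι) else 1 := by
    intro i
    rw [← Finsupp.prod_finsetSum_index (h := fun j k => x i j ^ k)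
      (by intro; simp) (by intro a b c; exact pow_add _ _ _)]
    refine Finset.prod_congr rfl fun ι _ => ?_
    split_ifs <;> simp
  simp only [h]
  rw [Finset.prod_comm]
  exact Finset.prod_congr rfl fun ι _ => by simp

theorem exists_sum_single_eq (k : ℕ) (α : ℕ →₀ ℕ) (hα : α.degree = k) :
    ∃ g : Fin k → ℕ, ∑ i, Finsupp.single (g i) 1 = α := by
  induction k generalizing α with
  | zero =>
    refine ⟨Fin.elim0, ?_⟩
    rw [(Finsupp.degree_eq_zero_iff α).1 hα]
    simp
  | succ k ih =>
    have h0 : α ≠ 0 := by rintro rfl; simp at hα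
    obtain ⟨j, hj⟩ := Finsupp.ne_iff.1 h0
    have hle : Finsupp.single j 1 ≤ α := by
      rw [Finsupp.single_le_iff]
      exact Nat.one_le_iff_ne_zero.2 hj
    have hadd : Finsupp.single j 1 + (α - Finsupp.single j 1) = α := add_tsub_cancel_of_le hle
    obtain ⟨g, hg⟩ := ih (α - Finsupp.single j 1) (by
      have := congrArg Finsupp.degree hadd
      rw [map_add, Finsupp.degree_single, hα] at this
      omega)
    refine ⟨Fin.cons j g, ?_⟩
    rw [Fin.sum_univ_succ]
    simp [hg, hadd]

theorem exists_countMultiIndex_eq (α : MultiIndex n) (F : Finset ℕ)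
    (hF : ∀ i, (α.1 i).support ⊆ F) :
    ∃ φ : (Σ i, Fin (n i)) → F, countMultiIndex n (fun ι => φ ι) = α := by
  choose g hg using fun i => exists_sum_single_eq (n i) (α.1 i) (α.2 i)
  have hmem : ∀ ι : Σ i, Fin (n i), g ι.1 ι.2 ∈ F := by
    intro ι
    apply hF ι.1
    rw [Finsupp.mem_support_iff, ← hg ι.1, Finsupp.finsetSum_apply]
    refine (Finset.sum_pos' (fun _ _ => Nat.zero_le _) ⟨ι.2, Finset.mem_univ _, ?_⟩).ne'
    simp
  refine ⟨fun ι => ⟨g ι.1 ι.2, hmem ι⟩, ?_⟩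
  apply Subtype.ext
  funext i
  simp only [countMultiIndex]
  rw [← hg i, Fintype.sum_sigma, Finset.sum_eq_single i]
  · simp
  · intro i' _ hi'
    simp [hi']
  · simp

theorem card_countMultiIndex_fiber_le [DecidableEq (MultiIndex n)] (F : Finset ℕ)
    (φ : (Σ i, Fin (n i)) → F) :
    (Finset.univ.filter fun ψ : (Σ i, Fin (n i)) → F =>
      countMultiIndex n (fun ι => ψ ι) = countMultiIndex n (fun ι => φ ι)).card ≤
      (∑ i, n i) ^ (∑ i, n i) := by
  classical
  have hsub : (Finset.univ.filter fun ψ : (Σ i, Fin (n i)) → F =>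
      countMultiIndex n (fun ι => ψ ι) = countMultiIndex n (fun ι => φ ι)) ⊆
      Finset.univ.image fun κ : (Σ i, Fin (n i)) → (Σ i, Fin (n i)) => φ ∘ κ := by
    intro ψ hψ
    have h := (Finset.mem_filter.1 hψ).2
    have hval : ∀ ι, ∃ ι', φ ι' = ψ ι := by
      intro ι
      have h1 : (countMultiIndex n (fun ι => φ ι)).1 ι.1 (ψ ι) ≠ 0 := by
        rw [← h]
        simp only [countMultiIndex, Finsupp.finsetSum_apply]
        refine (Finset.sum_pos' (fun _ _ => Nat.zero_le _) ⟨ι, Finset.mem_univ _, ?_⟩).ne'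
        simp
      simp only [countMultiIndex, Finsupp.finsetSum_apply] at h1
      obtain ⟨ι', _, hι'⟩ := Finset.exists_ne_zero_of_sum_ne_zero h1
      refine ⟨ι', ?_⟩
      by_contra hne
      apply hι'
      split_ifs
      · exact Finsupp.single_eq_of_ne fun h => hne (Subtype.ext h.symm)
      · rfl
    choose κ hκ using hval
    exact Finset.mem_image.2 ⟨κ, Finset.mem_univ _, funext hκ⟩
  refine (Finset.card_le_card hsub).trans (Finset.card_image_le.trans ?_)
  simp

open Classical in
/-- The coefficients of the symmetric form attached to a polynomial with coefficients `c`: each `c α` is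
shared equally between the index functions with counting multi-index `α`. -/
noncomputable def symmCoeff (c : MultiIndex n → 𝕜) (F : Finset ℕ) (φ : (Σ i, Fin (n i)) → F) : 𝕜 :=
  c (countMultiIndex n fun ι => φ ι) / ((Finset.univ.filter fun ψ : (Σ i, Fin (n i)) → F =>
      countMultiIndex n (fun ι => ψ ι) = countMultiIndex n (fun ι => φ ι)).card : 𝕜)

theorem norm_le_norm_symmCoeff (c : MultiIndex n → 𝕜) (F : Finset ℕ)
    (φ : (Σ i, Fin (n i)) → F) :
    ‖c (countMultiIndex n fun ι => φ ι)‖ ≤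
      ((∑ i, n i) ^ (∑ i, n i) : ℕ) * ‖symmCoeff c F φ‖ := by
  classical
  have hcard := card_countMultiIndex_fiber_le F φ
  have hpos : 0 < (Finset.univ.filter fun ψ : (Σ i, Fin (n i)) → F =>
      countMultiIndex n (fun ι => ψ ι) = countMultiIndex n (fun ι => φ ι)).card :=
    Finset.card_pos.2 ⟨φ, by simp⟩
  have h0 : (0 : ℝ) < ((Finset.univ.filter fun ψ : (Σ i, Fin (n i)) → F =>
      countMultiIndex n (fun ι => ψ ι) = countMultiIndex n (fun ι => φ ι)).card : ℝ) := by
    exact_mod_cast hpos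
  rw [symmCoeff, norm_div, RCLike.norm_natCast]
  have h1 : ((Finset.univ.filter fun ψ : (Σ i, Fin (n i)) → F =>
      countMultiIndex n (fun ι => ψ ι) = countMultiIndex n (fun ι => φ ι)).card : ℝ) ≤
      ((∑ i, n i) ^ (∑ i, n i) : ℕ) := by exact_mod_cast hcard
  calc _ = ((Finset.univ.filter fun ψ : (Σ i, Fin (n i)) → F =>
      countMultiIndex n (fun ι => ψ ι) = countMultiIndex n (fun ι => φ ι)).card : ℝ) *
        (‖c (countMultiIndex n fun ι => φ ι)‖ / _) := (mul_div_cancel₀ _ h0.ne').symm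
    _ ≤ _ := by gcongr

theorem symmCoeff_comp (c : MultiIndex n → 𝕜) (F : Finset ℕ) (φ : (Σ i, Fin (n i)) → F)
    (σ : Equiv.Perm (Σ i, Fin (n i))) (hσ : ∀ ι, (σ ι).1 = ι.1) :
    symmCoeff c F (φ ∘ σ) = symmCoeff c F φ := by
  have h : countMultiIndex n (fun ι => ((φ ∘ σ) ι : ℕ)) = countMultiIndex n (fun ι => φ ι) :=
    countMultiIndex_comp (fun ι => (φ ι : ℕ)) σ hσ
  simp only [symmCoeff, h]

/-- On sequences supported in a finite set, a polynomial is the restriction of its symmetric form to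
arguments that agree within each block. -/
theorem apply_lpOfFinset {p : ℝ≥0∞} {P : (Fin m → lp (fun _ : ℕ => 𝕜) p) → 𝕜}
    {c : MultiIndex n → 𝕜} (hc : IsMonomialExpansion n P c) (F : Finset ℕ) (z : Fin m → F → 𝕜) :
    P (fun i => lpOfFinset 𝕜 p F (z i)) =
      ∑ φ : (Σ i, Fin (n i)) → F, symmCoeff c F φ * ∏ ι : Σ i, Fin (n i), z ι.1 (φ ι) := by
  classical
  have h1 := hc (fun i => lpOfFinset 𝕜 p F (z i)) fun i => by
    refine F.finite_toSet.subset fun j hj => ?_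
    by_contra h
    exact hj (lpOfFinset_apply_notMem p F (z i) h)
  refine h1.unique ?_
  have h2 := hasSum_sum_of_ne_finset_zero (L := SummationFilter.unconditional _)
    (s := Finset.univ.image fun φ : (Σ i, Fin (n i)) → F => countMultiIndex n fun ι => φ ι)
    (f := fun α : MultiIndex n =>
      c α * monomialValue α.1 (fun i => lpOfFinset 𝕜 p F (z i))) (by
    intro α hα
    have hsupp : ¬ ∀ i, (α.1 i).support ⊆ F := by
      intro h
      obtain ⟨φ, hφ⟩ := exists_countMultiIndex_eq α F h
      exact hα (Finset.mem_image.2 ⟨φ, Finset.mem_univ _, hφ⟩)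
    push Not at hsupp
    obtain ⟨i, hi⟩ := hsupp
    obtain ⟨j, hj, hjF⟩ := Finset.not_subset.1 hi
    have hz : ((α.1 i).prod fun j k => (lpOfFinset 𝕜 p F (z i) : ℕ → 𝕜) j ^ k) = 0 := by
      have h0 : lpOfFinset 𝕜 p F (z i) j ^ α.1 i j = 0 := by
        rw [lpOfFinset_apply_notMem p F (z i) hjF]
        exact zero_pow (Finsupp.mem_support_iff.1 hj)
      exact Finset.prod_eq_zero hj h0
    rw [monomialValue, Finset.prod_eq_zero (Finset.mem_univ i) hz, mul_zero])
  convert h2 using 1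
  have h3 := Finset.sum_comp (s := Finset.univ)
    (fun α : MultiIndex n => c α * monomialValue α.1 (fun i => lpOfFinset 𝕜 p F (z i)) /
      ((Finset.univ.filter fun ψ : (Σ i, Fin (n i)) → F =>
        countMultiIndex n (fun ι => ψ ι) = α).card : 𝕜))
    (fun φ : (Σ i, Fin (n i)) → F => countMultiIndex n fun ι => φ ι)
  refine Eq.trans ?_ (h3.trans ?_)
  · refine Finset.sum_congr rfl fun φ _ => ?_
    rw [monomialValue_countMultiIndex]
    simp only [lpOfFinset_apply_mem, symmCoeff]
    rw [div_mul_eq_mul_div]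
  · refine Finset.sum_congr rfl fun α hα => ?_
    obtain ⟨φ, _, hφ⟩ := Finset.mem_image.1 hα
    have hpos : 0 < (Finset.univ.filter fun ψ : (Σ i, Fin (n i)) → F =>
        countMultiIndex n (fun ι => ψ ι) = α).card :=
      Finset.card_pos.2 ⟨φ, by simp [hφ]⟩
    rw [nsmul_eq_mul, mul_div_cancel₀]
    exact_mod_cast hpos.ne'

/-- The symmetric form of a polynomial bounded by `L` on the unit ball is bounded on the unit ball, by the
polarization formula. -/
theorem norm_symmForm_le {p : ℝ} (hp1 : 1 ≤ p) (hM : 0 < ∑ i, n i)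
    {P : (Fin m → lp (fun _ : ℕ => 𝕜) (ENNReal.ofReal p)) → 𝕜}
    {c : MultiIndex n → 𝕜} (hc : IsMonomialExpansion n P c) {L : ℝ}
    (hL : ∀ x, (∀ i, ‖x i‖ ≤ 1) → ‖P x‖ ≤ L) (F : Finset ℕ)
    (y : (Σ i, Fin (n i)) → F → 𝕜) (hy : ∀ ι, ∑ j, ‖y ι j‖ ^ p ≤ 1) :
    ‖∑ φ : (Σ i, Fin (n i)) → F, symmCoeff c F φ * ∏ ι, y ι (φ ι)‖ ≤
      ((∑ i, n i : ℕ) : ℝ) ^ (∑ i, n i) * L := by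
  classical
  have hp0 : 0 < p := by linarith
  have : Fact (1 ≤ ENNReal.ofReal p) := ⟨by simpa using ENNReal.ofReal_le_ofReal hp1⟩
  have hpR : (ENNReal.ofReal p).toReal = p := ENNReal.toReal_ofReal hp0.le
  set M := ∑ i, n i with hMdef
  have hM' : (M : ℝ) ≠ 0 := by exact_mod_cast hM.ne'
  have hM𝕜 : (M : 𝕜) ≠ 0 := by exact_mod_cast hM.ne'
  have hcardI : Fintype.card (Σ i, Fin (n i)) = M := by simp [hMdef]
  have hylp : ∀ ι, ‖lpOfFinset 𝕜 (ENNReal.ofReal p) F (y ι)‖ ≤ 1 := by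
    intro ι
    have h := norm_lpOfFinset_rpow (p := ENNReal.ofReal p) (by rw [hpR]; exact hp0) F (y ι)
    rw [hpR] at h
    rw [← Real.rpow_le_rpow_iff (norm_nonneg _) zero_le_one hp0, h, Real.one_rpow]
    exact hy ι
  obtain ⟨N, hN, hpol⟩ := polarization (fun ι : Σ i, Fin (n i) => ι.1) (symmCoeff c F)
    (fun σ hσ φ => symmCoeff_comp c F φ σ hσ) y
  have hterm : ∀ ε : (Σ i, Fin (n i)) → ℤˣ,
      ‖(∏ i, ((ε i : ℤ) : 𝕜)) * ∑ φ : (Σ i, Fin (n i)) → F, symmCoeff c F φ *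
        ∏ i, ∑ k with k.1 = i.1, ((ε k : ℤ) : 𝕜) * y k (φ i)‖ ≤ (M : ℝ) ^ M * L := by
    intro ε
    have hε : ∀ i, ‖((ε i : ℤ) : 𝕜)‖ = 1 := by
      intro i
      rcases Int.units_eq_one_or (ε i) with h | h <;> simp [h]
    -- The arguments are divided by `M`, which brings them into the unit ball.
    let z : Fin m → F → 𝕜 := fun i =>
      (M : 𝕜)⁻¹ • ∑ k : Σ i, Fin (n i) with k.1 = i, ((ε k : ℤ) : 𝕜) • y k
    have hz : ∀ i, ‖lpOfFinset 𝕜 (ENNReal.ofReal p) F (z i)‖ ≤ 1 := by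
      intro i
      simp only [z, map_smul, map_sum, norm_smul, norm_inv, RCLike.norm_natCast]
      rw [inv_mul_le_one₀ (by positivity)]
      refine (norm_sum_le _ _).trans ?_
      calc ∑ k : Σ i, Fin (n i) with k.1 = i,
            ‖((ε k : ℤ) : 𝕜) • lpOfFinset 𝕜 (ENNReal.ofReal p) F (y k)‖
          ≤ ∑ k : Σ i, Fin (n i), (1 : ℝ) := by
            refine (Finset.sum_le_sum_of_subset_of_nonneg (Finset.filter_subset _ _)
              fun _ _ _ => norm_nonneg _).trans (Finset.sum_le_sum fun k _ => ?_)
            rw [norm_smul, hε, one_mul]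
            exact hylp k
        _ = M := by simp [hMdef]
    have h1 := hL _ hz
    rw [apply_lpOfFinset hc] at h1
    have h2 : ∑ φ : (Σ i, Fin (n i)) → F, symmCoeff c F φ *
        ∏ i, ∑ k with k.1 = i.1, ((ε k : ℤ) : 𝕜) * y k (φ i) =
        (M : 𝕜) ^ M * ∑ φ : (Σ i, Fin (n i)) → F, symmCoeff c F φ * ∏ ι, z ι.1 (φ ι) := by
      rw [Finset.mul_sum]
      refine Finset.sum_congr rfl fun φ _ => ?_
      have h3 : ∀ ι : Σ i, Fin (n i), ∑ k with k.1 = ι.1, ((ε k : ℤ) : 𝕜) * y k (φ ι) =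
          (M : 𝕜) * z ι.1 (φ ι) := by
        intro ι
        simp only [z, Pi.smul_apply, Finset.sum_apply, smul_eq_mul]
        rw [mul_inv_cancel_left₀ hM𝕜]
      simp only [h3]
      rw [Finset.prod_mul_distrib, Finset.prod_const, Finset.card_univ, hcardI]
      ring
    rw [h2, norm_mul, norm_mul, norm_prod, norm_pow, RCLike.norm_natCast]
    simp only [hε, Finset.prod_const_one, one_mul]
    gcongr
  have h4 := norm_sum_le_of_le (Finset.univ (α := (Σ i, Fin (n i)) → ℤˣ)) fun ε _ => hterm ε
  rw [hpol, Finset.sum_const, Finset.card_univ, nsmul_eq_mul, norm_mul, norm_mul,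
    RCLike.norm_natCast, RCLike.norm_natCast] at h4
  have hc0 : (0 : ℝ) < Fintype.card ((Σ i, Fin (n i)) → ℤˣ) := by exact_mod_cast Fintype.card_pos
  have hN1 : (1 : ℝ) ≤ N := by exact_mod_cast hN
  refine le_of_mul_le_mul_left (le_trans ?_ h4) hc0
  gcongr
  exact le_mul_of_one_le_left hc0.le hN1

/-- The coefficients of a polynomial bounded on the unit ball of `ℓ_p`, `M < p ≤ 2 M`, are summable in every
order `s ≥ p / (p - M)`, with a bound independent of the number of variables involved. -/
theorem sum_coeff_rpow_le {p s : ℝ} (hM : 0 < ∑ i, n i) (hMp : ((∑ i, n i : ℕ) : ℝ) < p)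
    (hpM : p ≤ 2 * ((∑ i, n i : ℕ) : ℝ)) (hs : p / (p - (∑ i, n i : ℕ)) ≤ s)
    {P : (Fin m → lp (fun _ : ℕ => 𝕜) (ENNReal.ofReal p)) → 𝕜}
    {c : MultiIndex n → 𝕜} (hc : IsMonomialExpansion n P c) {L : ℝ}
    (hL : ∀ x, (∀ i, ‖x i‖ ≤ 1) → ‖P x‖ ≤ L) (T : Finset (MultiIndex n)) :
    ∑ α ∈ T, ‖c α‖ ^ s ≤ (((∑ i, n i) ^ (∑ i, n i) : ℕ) *
      (2 ^ (∑ i, n i) * (((∑ i, n i : ℕ) : ℝ) ^ (∑ i, n i) * L))) ^ s := by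
  classical
  have hp1 : 1 ≤ p := le_trans (by exact_mod_cast hM) hMp.le
  have hs0 : 0 ≤ s := le_trans (div_nonneg (by linarith) (by linarith)) hs
  have hL0 : 0 ≤ L := (norm_nonneg _).trans (hL 0 (by simp))
  have hcardI : Fintype.card (Σ i, Fin (n i)) = ∑ i, n i := by simp
  have : Nonempty (Σ i, Fin (n i)) := Fintype.card_pos_iff.1 (by rw [hcardI]; exact hM)
  let F : Finset ℕ := T.biUnion fun α => Finset.univ.biUnion fun i => (α.1 i).support
  have hF : ∀ α ∈ T, ∀ i, (α.1 i).support ⊆ F := fun α hα i j hj =>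
    Finset.mem_biUnion.2 ⟨α, hα, Finset.mem_biUnion.2 ⟨i, Finset.mem_univ _, hj⟩⟩
  have hform := sum_rpow_le_of_form_le (symmCoeff c F) (p := p) (s := s)
    (by rwa [hcardI]) (by rwa [hcardI]) (by rwa [hcardI])
    (fun y hy => norm_symmForm_le hp1 hM hc hL F y hy)
  rw [hcardI] at hform
  set A : ℝ := (((∑ i, n i) ^ (∑ i, n i) : ℕ) : ℝ) with hA
  have hA0 : 0 ≤ A := by positivity
  calc ∑ α ∈ T, ‖c α‖ ^ s
      ≤ ∑ α ∈ Finset.univ.image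
          (fun φ : (Σ i, Fin (n i)) → F => countMultiIndex n fun ι => φ ι), ‖c α‖ ^ s := by
        refine Finset.sum_le_sum_of_subset_of_nonneg (fun α hα => ?_) fun _ _ _ => by positivity
        obtain ⟨φ, hφ⟩ := exists_countMultiIndex_eq α F (hF α hα)
        exact Finset.mem_image.2 ⟨φ, Finset.mem_univ _, hφ⟩
    _ ≤ ∑ φ : (Σ i, Fin (n i)) → F, ‖c (countMultiIndex n fun ι => φ ι)‖ ^ s :=
        Finset.sum_image_le_of_nonneg fun _ _ => by positivity
    _ ≤ ∑ φ : (Σ i, Fin (n i)) → F, A ^ s * ‖symmCoeff c F φ‖ ^ s := by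
        refine Finset.sum_le_sum fun φ _ => ?_
        rw [← Real.mul_rpow hA0 (norm_nonneg _)]
        exact Real.rpow_le_rpow (norm_nonneg _) (norm_le_norm_symmCoeff c F φ) hs0
    _ ≤ A ^ s * _ := by
        rw [← Finset.mul_sum]
        gcongr
    _ = _ := (Real.mul_rpow hA0 (by positivity)).symm

end Sufficiency

/-! ### Diagonal polynomials -/

section Necessity

variable {𝕜 : Type*} [RCLike 𝕜] {m : ℕ}

/-- The diagonal polynomial `∑_{j < N} (x⁽¹⁾_j)^n₁ ⋯ (x⁽ᵐ⁾_j)^nₘ`. -/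
noncomputable def diagPoly (𝕜 : Type*) [RCLike 𝕜] (p : ℝ≥0∞) (n : Fin m → ℕ) (N : ℕ)
    (x : Fin m → lp (fun _ : ℕ => 𝕜) p) : 𝕜 :=
  ∑ j ∈ Finset.range N, ∏ i, x i j ^ n i

theorem isMultiPoly_diagPoly (p : ℝ≥0∞) (n : Fin m → ℕ) (N : ℕ) :
    IsMultiPoly 𝕜 n (diagPoly 𝕜 p n N) := by
  classical
  intro i x
  refine ⟨∑ j ∈ Finset.range N, (∏ l ∈ Finset.univ.erase i, x l j ^ n l) •
    (MultilinearMap.mkPiAlgebra 𝕜 (Fin (n i)) 𝕜).compLinearMap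
      (fun _ => lp.evalₗ (𝕜 := 𝕜) (fun _ : ℕ => 𝕜) p j), fun y => ?_⟩
  simp only [diagPoly, sum_apply, smul_apply,
    MultilinearMap.compLinearMap_apply, MultilinearMap.mkPiAlgebra_apply, Finset.prod_const,
    Finset.card_univ, Fintype.card_fin, smul_eq_mul]
  refine Finset.sum_congr rfl fun j _ => ?_
  rw [← Finset.prod_erase_mul _ _ (Finset.mem_univ i), Function.update_self]
  congr 1
  refine Finset.prod_congr rfl fun l hl => ?_
  rw [Function.update_of_ne (Finset.ne_of_mem_erase hl)]

/-- The multi-index of the monomial `(x⁽¹⁾_j)^n₁ ⋯ (x⁽ᵐ⁾_j)^nₘ`. -/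
noncomputable def diagMultiIndex (n : Fin m → ℕ) (j : ℕ) : MultiIndex n :=
  ⟨fun i => Finsupp.single j (n i), fun i => by simp⟩

theorem diagMultiIndex_injective (hm : 0 < m) {n : Fin m → ℕ} (hn : ∀ i, 0 < n i) :
    Function.Injective (diagMultiIndex n) := by
  intro j j' h
  have h1 := congrFun (congrArg Subtype.val h) ⟨0, hm⟩
  exact Finsupp.single_left_injective (hn _).ne' h1

open Classical in
theorem isMonomialExpansion_diagPoly (hm : 0 < m) (p : ℝ≥0∞) {n : Fin m → ℕ} (hn : ∀ i, 0 < n i)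
    (N : ℕ) : IsMonomialExpansion n (diagPoly 𝕜 p n N)
      (fun α => if α ∈ (Finset.range N).image (diagMultiIndex n) then 1 else 0) := by
  intro x _
  have h := hasSum_sum_of_ne_finset_zero (L := SummationFilter.unconditional _)
    (s := (Finset.range N).image (diagMultiIndex n))
    (f := fun α : MultiIndex n => (if α ∈ (Finset.range N).image (diagMultiIndex n) then 1 else 0) *
      monomialValue α.1 (fun i => (x i : ℕ → 𝕜))) (by
    intro α hα
    rw [if_neg hα, zero_mul])
  convert h using 1
  rw [Finset.sum_image fun _ _ _ _ h => diagMultiIndex_injective hm hn h]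
  refine Finset.sum_congr rfl fun j hj => ?_
  rw [if_pos (Finset.mem_image_of_mem _ hj), one_mul]
  simp [monomialValue, diagMultiIndex]

theorem multiNorm_diagPoly_le (hm : 0 < m) {n : Fin m → ℕ} (hn : ∀ i, 0 < n i) {p : ℝ}
    (hMp : ((∑ i, n i : ℕ) : ℝ) < p) (N : ℕ) :
    multiNorm (diagPoly 𝕜 (ENNReal.ofReal p) n N) ≤
      ENNReal.ofReal ((N : ℝ) ^ (1 - ((∑ i, n i : ℕ) : ℝ) / p)) := by
  set M : ℝ := ((∑ i, n i : ℕ) : ℝ) with hM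
  have hM0 : 0 < M := by
    rw [hM]
    exact_mod_cast Finset.sum_pos (fun i _ => hn i) ⟨⟨0, hm⟩, Finset.mem_univ _⟩
  have hp0 : 0 < p := hM0.trans hMp
  have hpR : (ENNReal.ofReal p).toReal = p := ENNReal.toReal_ofReal hp0.le
  have hM1 : ∑ i, (n i : ℝ) / M = 1 := by
    rw [← Finset.sum_div, hM, Nat.cast_sum, div_self]
    simpa [hM] using hM0.ne'
  refine iSup₂_le fun x hx => ?_
  rw [← ofReal_norm]
  refine ENNReal.ofReal_le_ofReal ?_
  -- By the inequality of the means it is enough to control one variable at a time.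
  have hAG : ∀ j, ‖∏ i, x i j ^ n i‖ ≤ ∑ i, (n i : ℝ) / M * ‖x i j‖ ^ M := by
    intro j
    have h := Real.geom_mean_le_arith_mean_weighted Finset.univ (fun i => (n i : ℝ) / M)
      (fun i => ‖x i j‖ ^ M) (fun _ _ => by positivity) hM1 (fun _ _ => by positivity)
    refine le_trans (le_of_eq ?_) h
    rw [norm_prod]
    refine Finset.prod_congr rfl fun i _ => ?_
    rw [norm_pow, ← Real.rpow_mul (norm_nonneg _), mul_div_cancel₀ _ hM0.ne', Real.rpow_natCast]
  have hone : ∀ i, ∑ j ∈ Finset.range N, ‖x i j‖ ^ M ≤ (N : ℝ) ^ (1 - M / p) := by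
    intro i
    have h1 : ∑ j ∈ Finset.range N, ‖x i j‖ ^ p ≤ 1 := by
      have h := lp.sum_rpow_le_norm_rpow (p := ENNReal.ofReal p) (by rw [hpR]; exact hp0) (x i)
        (Finset.range N)
      rw [hpR] at h
      exact h.trans (Real.rpow_le_one (lp.norm_nonneg' _) (hx i) hp0.le)
    have hq : 1 ≤ p / M := (one_le_div hM0).2 hMp.le
    have h2 := Real.rpow_sum_le_const_mul_sum_rpow_of_nonneg (Finset.range N) hq
      (f := fun j => ‖x i j‖ ^ M) (fun _ _ => by positivity)
    have h3 : ∀ j, (‖x i j‖ ^ M) ^ (p / M) = ‖x i j‖ ^ p := by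
      intro j
      rw [← Real.rpow_mul (norm_nonneg _), mul_div_cancel₀ _ hM0.ne']
    simp only [h3, Finset.card_range] at h2
    have h4 : (∑ j ∈ Finset.range N, ‖x i j‖ ^ M) ^ (p / M) ≤ (N : ℝ) ^ (p / M - 1) :=
      h2.trans (mul_le_of_le_one_right (by positivity) h1)
    rw [← Real.rpow_le_rpow_iff (Finset.sum_nonneg fun _ _ => by positivity) (by positivity)
      (by positivity : 0 < p / M), ← Real.rpow_mul (by positivity)]
    refine h4.trans (le_of_eq ?_)
    congr 1
    field_simp
  calc ‖diagPoly 𝕜 (ENNReal.ofReal p) n N x‖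
      ≤ ∑ j ∈ Finset.range N, ∑ i, (n i : ℝ) / M * ‖x i j‖ ^ M :=
        norm_sum_le_of_le _ fun j _ => hAG j
    _ = ∑ i, (n i : ℝ) / M * ∑ j ∈ Finset.range N, ‖x i j‖ ^ M := by
        rw [Finset.sum_comm]
        simp only [Finset.mul_sum]
    _ ≤ ∑ i, (n i : ℝ) / M * (N : ℝ) ^ (1 - M / p) := by
        gcongr with i
        exact hone i
    _ = _ := by rw [← Finset.sum_mul, hM1, one_mul]

/-- The coefficient inequality, tested on the diagonal polynomials. -/
theorem rpow_le_of_coeff_inequality (hm : 0 < m) {n : Fin m → ℕ} (hn : ∀ i, 0 < n i) {p s C : ℝ}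
    (hs : 0 < s) (hC : 0 ≤ C) (hMp : ((∑ i, n i : ℕ) : ℝ) < p)
    (h : ∀ (P : (Fin m → lp (fun _ : ℕ => 𝕜) (ENNReal.ofReal p)) → 𝕜) (hP : IsMultiPoly 𝕜 n P),
        (∑' α : MultiIndex n, ‖multiCoeff hP α‖ₑ ^ s) ^ (1 / s) ≤
          ENNReal.ofReal C * multiNorm P) (N : ℕ) :
    (N : ℝ) ^ (1 / s) ≤ C * (N : ℝ) ^ (1 - ((∑ i, n i : ℕ) : ℝ) / p) := by
  classical
  have hP := isMultiPoly_diagPoly (𝕜 := 𝕜) (ENNReal.ofReal p) n N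
  have hcoeff : multiCoeff hP = fun α =>
      if α ∈ (Finset.range N).image (diagMultiIndex n) then 1 else 0 :=
    hP.existsUnique_expansion.unique (multiCoeff_spec hP)
      (isMonomialExpansion_diagPoly hm (ENNReal.ofReal p) hn N)
  have h1 := (h _ hP).trans (mul_le_mul_right (multiNorm_diagPoly_le (𝕜 := 𝕜) hm hn hMp N) _)
  have h2 : (N : ℝ≥0∞) ≤ ∑' α : MultiIndex n, ‖multiCoeff hP α‖ₑ ^ s := by
    refine le_trans (le_of_eq ?_)
      (ENNReal.sum_le_tsum ((Finset.range N).image (diagMultiIndex n)))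
    rw [Finset.sum_congr rfl (g := fun _ => (1 : ℝ≥0∞))]
    · rw [Finset.sum_const, Finset.card_image_of_injective _ (diagMultiIndex_injective hm hn)]
      simp
    · intro α hα
      rw [hcoeff]
      simp only [if_pos hα]
      simp
  have h3 := (ENNReal.rpow_le_rpow h2 (by positivity : 0 ≤ 1 / s)).trans h1
  rw [← ENNReal.ofReal_mul hC, ← ENNReal.ofReal_natCast,
    ENNReal.ofReal_rpow_of_nonneg (by positivity) (by positivity)] at h3
  exact (ENNReal.ofReal_le_ofReal_iff (by positivity)).1 h3

theorem le_of_forall_natCast_rpow_le {u v C : ℝ} (h : ∀ N : ℕ, (N : ℝ) ^ u ≤ C * (N : ℝ) ^ v) :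
    u ≤ v := by
  by_contra! huv
  have ht := (tendsto_rpow_atTop (sub_pos.2 huv)).comp (tendsto_natCast_atTop_atTop (R := ℝ))
  obtain ⟨N, hN, hN0⟩ := ((ht.eventually_gt_atTop C).and (Filter.eventually_gt_atTop 0)).exists
  have hN0' : (0 : ℝ) < N := by exact_mod_cast hN0
  have h1 := h N
  rw [← div_le_iff₀ (by positivity), ← Real.rpow_sub hN0'] at h1
  exact absurd (hN.trans_le h1) (lt_irrefl _)

end Necessity

end MultiPolyAux

/-! ### The critical exponent -/

open MultiPolyAux in
theorem mainTheorem2 {𝕜 : Type*} [RCLike 𝕜] (m : ℕ) (hm : 0 < m) (n : Fin m → ℕ)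
    (hn : ∀ j, 0 < n j) (M : ℕ) (hM : M = ∑ j, n j) (p : ℝ) (hMp : (M : ℝ) < p)
    (hpM : p ≤ 2 * (M : ℝ)) (s : ℝ) (hs : 0 < s) :
    (∃ C : ℝ, 1 ≤ C ∧
      ∀ (P : (Fin m → lp (fun _ : ℕ => 𝕜) (ENNReal.ofReal p)) → 𝕜) (hP : IsMultiPoly 𝕜 n P),
        (∑' α : MultiIndex n, ‖multiCoeff hP α‖ₑ ^ s) ^ (1 / s) ≤
          ENNReal.ofReal C * multiNorm P) ↔
      p / (p - (M : ℝ)) ≤ s := by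
  subst hM
  have hMpos : 0 < ∑ j, n j := Finset.sum_pos (fun i _ => hn i) ⟨⟨0, hm⟩, Finset.mem_univ _⟩
  have hp0 : 0 < p := lt_of_le_of_lt (by positivity) hMp
  have hpM' : 0 < p - ((∑ j, n j : ℕ) : ℝ) := sub_pos.2 hMp
  constructor
  · rintro ⟨C, hC, h⟩
    have h1 := le_of_forall_natCast_rpow_le
      (rpow_le_of_coeff_inequality hm hn hs (zero_le_one.trans hC) hMp h)
    rw [one_sub_div hp0.ne', div_le_div_iff₀ hs hp0, one_mul] at h1
    rwa [div_le_iff₀ hpM', mul_comm]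
  · intro hs'
    set D : ℝ := (((∑ i, n i) ^ (∑ i, n i) : ℕ) : ℝ) *
      (2 ^ (∑ i, n i) * ((∑ i, n i : ℕ) : ℝ) ^ (∑ i, n i)) with hD
    have hM1 : (1 : ℝ) ≤ ((∑ i, n i : ℕ) : ℝ) := by exact_mod_cast hMpos
    have hD1 : 1 ≤ D := by
      rw [hD, Nat.cast_pow]
      exact one_le_mul_of_one_le_of_one_le (one_le_pow₀ hM1)
        (one_le_mul_of_one_le_of_one_le (one_le_pow₀ one_le_two) (one_le_pow₀ hM1))
    have hD0 : 0 < D := zero_lt_one.trans_le hD1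
    refine ⟨D, hD1, fun P hP => ?_⟩
    by_cases hfin : multiNorm P = ∞
    · rw [hfin, ENNReal.mul_top (by simpa using hD0)]
      exact le_top
    set L := (multiNorm P).toReal with hLdef
    have hL : ∀ x : Fin m → lp (fun _ : ℕ => 𝕜) (ENNReal.ofReal p), (∀ i, ‖x i‖ ≤ 1) →
        ‖P x‖ ≤ L := by
      intro x hx
      have h1 : ‖P x‖ₑ ≤ multiNorm P :=
        le_iSup₂ (f := fun (x : Fin m → lp (fun _ : ℕ => 𝕜) (ENNReal.ofReal p))
          (_ : ∀ i, ‖x i‖ ≤ 1) => ‖P x‖ₑ) x hx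
      rw [← toReal_enorm]
      exact ENNReal.toReal_mono hfin h1
    have hL0 : 0 ≤ L := ENNReal.toReal_nonneg
    have hLe : multiNorm P = ENNReal.ofReal L := (ENNReal.ofReal_toReal hfin).symm
    rw [hLe, ← ENNReal.ofReal_mul hD0.le, one_div,
      ENNReal.rpow_inv_le_iff hs, ENNReal.tsum_eq_iSup_sum]
    refine iSup_le fun T => ?_
    have h2 := sum_coeff_rpow_le hMpos hMp hpM hs' (multiCoeff_spec hP) hL T
    rw [ENNReal.ofReal_rpow_of_nonneg (by positivity) hs.le]
    have h3 : ∀ α, ‖multiCoeff hP α‖ₑ ^ s = ENNReal.ofReal (‖multiCoeff hP α‖ ^ s) := by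
      intro α
      rw [← ofReal_norm, ENNReal.ofReal_rpow_of_nonneg (norm_nonneg _) hs.le]
    simp only [h3]
    rw [← ENNReal.ofReal_sum_of_nonneg fun _ _ => by positivity]
    refine ENNReal.ofReal_le_ofReal (h2.trans (le_of_eq ?_))
    rw [hD]
    congr 1
    ring
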